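/- Let $p$ be a prime, $k\ge 1$ and $q=p^k$ with $q\equiv 1\pmod 3$, and let $n$ be a positive integer with $\gcd\left(n,\frac{q-1}{3}\right)=1$. Define the integer $\kappa_p$ as follows: $\kappa_7=1$; $\kappa_{13}=-5$; if $p\equiv 1\pmod 3$ and $p\ge 19$, then $\kappa_p$ is the integer that satisfies $$|\kappa_p|\le 2\sqrt p\quad\text{and}\quad \kappa_p\equiv-\binom{\frac{p-1}{2}}{\frac{p-1}{3}}\cdot 4^{-\frac{p-1}{6}}\pmod p;$$ and $\kappa_p=0$ if $p\equiv 2\pmod 3$. Then $\kappa_p$ is well defined, that is, exactly one integer satisfies these conditions. Moreover, put $$\pi_p=-\frac{\kappa_p}{2}+i\sqrt{p-\frac{\kappa_p^2}{4}}\in\mathbb C,$$ $$\epsilon_1=\begin{cases}-2,&\text{if } q-3n\equiv 1\pmod 9,\\ 1,&\text{otherwise,}\end{cases}\qquad \epsilon_2=\begin{cases}-2,&\text{if } n\equiv 0\pmod 3,\\ 1,&\text{otherwise.}\end{cases}$$ Then the number of elements $a\in\mathbb F_q$ for which the binomial $x^n\left(x^{\frac{q-1}{3}}+a\right)$ permutes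 $\mathbb F_q$ is exactly $$\frac{2q-3(\epsilon_1+\epsilon_2)-10-2\left(\pi_p^{\,k}+\overline{\pi_p}^{\,k}\right)}{9}.$$ -/

import Mathlib

/-- A polynomial over a field is a permutation polynomial if its evaluation map
permutes the field. -/
def IsPermutationPolynomial {F : Type*} [Field F] (f : Polynomial F) : Prop :=
  Function.Bijective (fun x : F => f.eval x)

/-- The conditions that determine the integer `κ_p`, for a prime `p ≠ 3`.
Here `(4 : ZMod p)⁻¹` is the inverse of `4` modulo `p`; when `p` is a prime with
`p ≡ 1 (mod 3)`, the quotients `(p - 1) / 2`, `(p - 1) / 3` and `(p - 1) / 6` are exact. -/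
def IsKappa (p : ℕ) (κ : ℤ) : Prop :=
  (p = 7 ∧ κ = 1) ∨
  (p = 13 ∧ κ = -5) ∨
  (p % 3 = 1 ∧ 19 ≤ p ∧ |(κ : ℝ)| ≤ 2 * Real.sqrt p ∧
    (κ : ZMod p) =
      -((Nat.choose ((p - 1) / 2) ((p - 1) / 3) : ℕ) : ZMod p) *
        (4 : ZMod p)⁻¹ ^ ((p - 1) / 6)) ∨
  (p % 3 = 2 ∧ κ = 0)

open Classical in
/-- The integer `κ_p`: the integer that satisfies `IsKappa p` (and `0` if there is none). -/
noncomputable def kappa (p : ℕ) : ℤ :=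
  if h : ∃ κ : ℤ, IsKappa p κ then h.choose else 0

/-- The complex number `π_p = -κ_p / 2 + i √(p - κ_p² / 4)`. -/
noncomputable def piFrob (p : ℕ) : ℂ :=
  -(kappa p : ℂ) / 2 + Complex.I * (Real.sqrt ((p : ℝ) - (kappa p : ℝ) ^ 2 / 4) : ℂ)

/-- `ε₁ = -2` if `q - 3n ≡ 1 (mod 9)`, and `ε₁ = 1` otherwise; the difference is in `ℤ`. -/
def epsOne (q n : ℕ) : ℤ :=
  if (q : ℤ) - 3 * (n : ℤ) ≡ 1 [ZMOD 9] then -2 else 1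

/-- `ε₂ = -2` if `n ≡ 0 (mod 3)`, and `ε₂ = 1` otherwise. -/
def epsTwo (n : ℕ) : ℤ :=
  if n ≡ 0 [MOD 3] then -2 else 1

/-! Write `s = (q - 1) / 3`. Since `gcd(n, s) = 1`, the binomial permutes the field iff no cube root
of unity is a root of `y + a` and `y ↦ y ^ n * (y + a) ^ s` permutes the cube roots of unity
(`isPermutationPolynomial_binomial_iff`). In terms of a cubic character `χ`, three values `ω ^ (i n)
χ(ζ ^ i + a)` must be distinct. A Möbius change of variable moves `-1, -ζ, -ζ²` to `0, 1, ∞`, and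
the condition becomes that `χ t`, `c χ(1 - t)`, `c ^ 2` are distinct, with `c = ω ^ (n + 2 s)`. The
image of `a = ∞` has to be discarded, which produces `ε₂`.

A polynomial indicator of distinctness turns the count of `t` into `2 (q - 2 + J + J̄) + 3 (c + c ^
2)`, divided by 9, where `J = jacobiSum χ χ`; the last term gives `ε₁` (`nine_mul_card_distinct`).

It remains to find `J + J̄`. For `p ≡ 1 (mod 3)`, the Hasse–Davenport relation
(`jacobiSum_compNorm`) reduces it to the Jacobi sum over `ZMod p`. That sum has absolute value `√p`,
and twice its real part is an integer whose residue mod `p` is a binomial coefficient, hence is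
`κ_p`. For `p ≡ 2 (mod 3)`, Frobenius makes `J` real, so `J = ±√q`, and a count mod 3 fixes the
sign. -/

open Polynomial in
theorem finite_monic_natDegree_eq (K : Type*) [Field K] [Finite K] (d : ℕ) :
    {f : K[X] | f.Monic ∧ f.natDegree = d}.Finite := by
  have : Finite (degreeLT K d) := Finite.of_equiv _ (degreeLTEquiv K d).toEquiv.symm
  exact Finite.of_equiv _ (monicEquivDegreeLT (R := K) d).symm

open Polynomial in
/-- The finite set of monic polynomials of degree `d` over a finite field. -/
noncomputable def monicsOfDegree (K : Type*) [Field K] [Finite K] (d : ℕ) : Finset K[X] :=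
  (finite_monic_natDegree_eq K d).toFinset

open Classical Polynomial in
/-- The finite set of monic irreducible polynomials of degree `d` over a finite field. -/
noncomputable def irreduciblesOfDegree (K : Type*) [Field K] [Finite K] (d : ℕ) : Finset K[X] :=
  (monicsOfDegree K d).filter Irreducible

/-! ### Newton's identity for completely multiplicative functions on monic polynomials. -/

section Newton

open Polynomial

variable {K : Type*} [Field K] [Finite K] {R : Type*} [CommRing R]

theorem mem_monicsOfDegree {d : ℕ} {f : K[X]} :
    f ∈ monicsOfDegree K d ↔ f.Monic ∧ f.natDegree = d := by
  simp [monicsOfDegree]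

theorem mem_irreduciblesOfDegree {d : ℕ} {f : K[X]} :
    f ∈ irreduciblesOfDegree K d ↔ (f.Monic ∧ f.natDegree = d) ∧ Irreducible f := by
  simp [irreduciblesOfDegree, mem_monicsOfDegree]

theorem monicsOfDegree_zero : monicsOfDegree K 0 = {1} := by
  ext f
  simp only [mem_monicsOfDegree, Finset.mem_singleton]
  refine ⟨fun h => h.1.natDegree_eq_zero.1 h.2, ?_⟩
  rintro rfl
  exact ⟨monic_one, natDegree_one⟩

theorem sum_monicsOfDegree_one (g : K[X] → R) [Fintype K] :
    ∑ f ∈ monicsOfDegree K 1, g f = ∑ a : K, g (X + C a) := by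
  symm
  refine Finset.sum_bij' (fun a _ => X + C a) (fun f _ => f.coeff 0) ?_ ?_ ?_ ?_ ?_
  · intro a _
    exact mem_monicsOfDegree.2 ⟨monic_X_add_C a, natDegree_X_add_C a⟩
  · intros; exact Finset.mem_univ _
  · intro a _
    simp
  · intro f hf
    obtain ⟨h1, h2⟩ := mem_monicsOfDegree.1 hf
    exact (h1.eq_X_add_C h2).symm
  · intros; rfl

/-- The analogue of the von Mangoldt sum: `∑ deg P * c(P) ^ e` over monic irreducible `P` and
`e ≥ 1` with `e * deg P = j`. -/
noncomputable def primePowerSum (c : K[X] →* R) (j : ℕ) : R :=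
  ∑ x ∈ j.divisorsAntidiagonal, ∑ P ∈ irreduciblesOfDegree K x.1, (x.1 : R) * c P ^ x.2

-- The multiplicity of `P` in `f` is the number of `e ≥ 1` with `P ^ e ∣ f`, and degrees add over
-- the factorization. This is the logarithmic derivative of the Euler product, read on a single `f`.
open Classical in
theorem natDegree_eq_sum_irreducible_pow_dvd {d : ℕ} {f : K[X]} (hf : f ∈ monicsOfDegree K d) :
    (d : R) = ∑ n ∈ Finset.Icc 1 d, ∑ P ∈ irreduciblesOfDegree K n, ∑ e ∈ Finset.Icc 1 d,
      if P ^ e ∣ f then (n : R) else 0 := by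
  obtain ⟨hm, hd⟩ := mem_monicsOfDegree.1 hf
  have hf0 : f ≠ 0 := hm.ne_zero
  set s := UniqueFactorizationMonoid.normalizedFactors f with hs
  have hprod : s.prod = f := by
    rw [hs, UniqueFactorizationMonoid.prod_normalizedFactors_eq hf0]
    exact hm.normalize_eq_self
  have hmem : ∀ P ∈ s, P.Monic ∧ Irreducible P := by
    intro P hP
    have h1 := UniqueFactorizationMonoid.irreducible_of_normalized_factor P hP
    refine ⟨?_, h1⟩
    rw [← UniqueFactorizationMonoid.normalize_normalized_factor P hP]
    exact monic_normalize h1.ne_zero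
  have hcount : ∀ n ∈ Finset.Icc 1 d, ∀ P ∈ irreduciblesOfDegree K n,
      (∑ e ∈ Finset.Icc 1 d, if P ^ e ∣ f then (n : R) else 0) = (n : R) * s.count P := by
    intro n hn P hP
    obtain ⟨⟨hPm, hPd⟩, hPi⟩ := mem_irreduciblesOfDegree.1 hP
    have hiff : ∀ e, P ^ e ∣ f ↔ e ≤ s.count P := by
      intro e
      rw [pow_dvd_iff_le_emultiplicity,
        UniqueFactorizationMonoid.emultiplicity_eq_count_normalizedFactors hPi hf0,
        hPm.normalize_eq_self]
      exact Nat.cast_le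
    have hle : s.count P ≤ d := by
      have h1 := natDegree_le_of_dvd ((hiff _).2 le_rfl) hf0
      rw [hPm.natDegree_pow, hPd, hd] at h1
      have := (Finset.mem_Icc.1 hn).1
      nlinarith
    rw [← Finset.sum_filter, Finset.sum_const]
    have : (Finset.Icc 1 d).filter (fun e => P ^ e ∣ f) = Finset.Icc 1 (s.count P) := by
      ext e
      simp only [Finset.mem_filter, Finset.mem_Icc, hiff]
      omega
    rw [this, Nat.card_Icc]
    simp [mul_comm]
  rw [Finset.sum_congr rfl fun n hn => Finset.sum_congr rfl (hcount n hn), Finset.sum_sigma']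
  have hdeg : d = (s.map natDegree).sum := by
    rw [← hd, ← hprod]
    refine natDegree_multiset_prod_of_monic s fun P hP => (hmem P hP).1
  conv_lhs => rw [hdeg, Finset.sum_multiset_map_count]
  push_cast
  refine Finset.sum_bij_ne_zero (fun P _ _ => ⟨P.natDegree, P⟩) ?_ ?_ ?_ ?_
  · intro P hP _
    have hP' := Multiset.mem_toFinset.1 hP
    have hi := hmem P hP'
    have h1 : P ∣ f := UniqueFactorizationMonoid.dvd_of_mem_normalizedFactors hP'
    refine Finset.mem_sigma.2 ⟨Finset.mem_Icc.2 ⟨hi.2.natDegree_pos, ?_⟩,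
      mem_irreduciblesOfDegree.2 ⟨⟨hi.1, rfl⟩, hi.2⟩⟩
    exact hd ▸ natDegree_le_of_dvd h1 hf0
  · intro P _ _ Q _ _ h
    simpa using (Sigma.mk.inj_iff.1 h).2
  · rintro ⟨n, P⟩ hP hne
    obtain ⟨h1, h2⟩ := Finset.mem_sigma.1 hP
    obtain ⟨⟨hPm, hPd⟩, hPi⟩ := mem_irreduciblesOfDegree.1 h2
    simp only at hPd hne
    subst hPd
    refine ⟨P, ?_, ?_, rfl⟩
    · rw [Multiset.mem_toFinset, ← Multiset.count_pos]
      refine Nat.pos_of_ne_zero fun h => hne ?_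
      simp [h]
    · simpa [mul_comm] using hne
  · intro P _ _
    simp [mul_comm]

open Classical in
theorem sum_monicsOfDegree_filter_dvd (c : K[X] →* R) {P : K[X]} (hP : P.Monic) (d : ℕ) :
    ∑ f ∈ (monicsOfDegree K d).filter (P ∣ ·), c f =
      if P.natDegree ≤ d then c P * ∑ g ∈ monicsOfDegree K (d - P.natDegree), c g else 0 := by
  split_ifs with h
  · rw [Finset.mul_sum]
    symm
    refine Finset.sum_bij (fun g _ => P * g) ?_ ?_ ?_ ?_
    · intro g hg
      obtain ⟨h1, h2⟩ := mem_monicsOfDegree.1 hg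
      refine Finset.mem_filter.2 ⟨mem_monicsOfDegree.2 ⟨hP.mul h1, ?_⟩, dvd_mul_right _ _⟩
      rw [hP.natDegree_mul h1]
      omega
    · intro g _ g' _ h
      exact mul_left_cancel₀ hP.ne_zero h
    · intro f hf
      obtain ⟨h1, g, rfl⟩ := Finset.mem_filter.1 hf
      obtain ⟨h1, h2⟩ := mem_monicsOfDegree.1 h1
      have hg := hP.of_mul_monic_left h1
      refine ⟨g, mem_monicsOfDegree.2 ⟨hg, ?_⟩, rfl⟩
      rw [hP.natDegree_mul hg] at h2
      omega
    · intro g _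
      rw [map_mul]
  · refine Finset.sum_eq_zero fun f hf => absurd ?_ h
    obtain ⟨h1, h2⟩ := Finset.mem_filter.1 hf
    obtain ⟨h3, rfl⟩ := mem_monicsOfDegree.1 h1
    exact natDegree_le_of_dvd h2 h3.ne_zero

/-- Newton's identity between the complete sums and the prime power sums of a completely
multiplicative function on the monic polynomials over a finite field. -/
theorem sum_monicsOfDegree_newton (c : K[X] →* R) (d : ℕ) :
    (d : R) * ∑ f ∈ monicsOfDegree K d, c f =
      ∑ j ∈ Finset.Icc 1 d, primePowerSum c j * ∑ g ∈ monicsOfDegree K (d - j), c g := by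
  classical
  calc (d : R) * ∑ f ∈ monicsOfDegree K d, c f
      = ∑ f ∈ monicsOfDegree K d, ∑ n ∈ Finset.Icc 1 d, ∑ P ∈ irreduciblesOfDegree K n,
          ∑ e ∈ Finset.Icc 1 d, if P ^ e ∣ f then (n : R) * c f else 0 := by
        rw [Finset.mul_sum]
        refine Finset.sum_congr rfl fun f hf => ?_
        rw [natDegree_eq_sum_irreducible_pow_dvd (R := R) hf]
        simp only [Finset.sum_mul, ite_mul, zero_mul]
    _ = ∑ n ∈ Finset.Icc 1 d, ∑ P ∈ irreduciblesOfDegree K n, ∑ e ∈ Finset.Icc 1 d,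
          ∑ f ∈ monicsOfDegree K d, if P ^ e ∣ f then (n : R) * c f else 0 := by
        rw [Finset.sum_comm]
        refine Finset.sum_congr rfl fun n _ => ?_
        rw [Finset.sum_comm]
        exact Finset.sum_congr rfl fun P _ => Finset.sum_comm
    _ = ∑ n ∈ Finset.Icc 1 d, ∑ P ∈ irreduciblesOfDegree K n, ∑ e ∈ Finset.Icc 1 d,
          if n * e ≤ d then
            (n : R) * c P ^ e * ∑ g ∈ monicsOfDegree K (d - n * e), c g else 0 := by
        refine Finset.sum_congr rfl fun n _ => Finset.sum_congr rfl fun P hP =>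
          Finset.sum_congr rfl fun e _ => ?_
        obtain ⟨⟨hPm, rfl⟩, -⟩ := mem_irreduciblesOfDegree.1 hP
        rw [← Finset.sum_filter, ← Finset.mul_sum,
          sum_monicsOfDegree_filter_dvd c (hPm.pow e), hPm.natDegree_pow, mul_comm e, map_pow]
        split_ifs <;> ring
    _ = ∑ n ∈ Finset.Icc 1 d, ∑ e ∈ Finset.Icc 1 d, if n * e ≤ d then
          (∑ P ∈ irreduciblesOfDegree K n, (n : R) * c P ^ e) *
            ∑ g ∈ monicsOfDegree K (d - n * e), c g else 0 := by
        refine Finset.sum_congr rfl fun n _ => ?_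
        rw [Finset.sum_comm]
        refine Finset.sum_congr rfl fun e _ => ?_
        split_ifs
        · rw [Finset.sum_mul]
        · simp
    _ = _ := by
        simp only [primePowerSum]
        set G : ℕ → ℕ → R := fun n e => ∑ P ∈ irreduciblesOfDegree K n, (n : R) * c P ^ e with hG
        set H : ℕ → R := fun j => ∑ g ∈ monicsOfDegree K j, c g with hH
        change ∑ n ∈ Finset.Icc 1 d, ∑ e ∈ Finset.Icc 1 d,
          (if n * e ≤ d then G n e * H (d - n * e) else 0) =
          ∑ j ∈ Finset.Icc 1 d, (∑ x ∈ j.divisorsAntidiagonal, G x.1 x.2) * H (d - j)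
        simp only [Finset.sum_mul]
        rw [← Finset.sum_product', ← Finset.sum_filter, Finset.sum_sigma']
        symm
        -- Pairs `(n, e)` with `n * e ≤ d` are grouped by their product `j`.
        refine Finset.sum_bij' (fun x _ => x.2) (fun y _ => ⟨y.1 * y.2, y⟩) ?_ ?_ ?_ ?_ ?_
        · rintro ⟨j, n, e⟩ h
          simp only [Finset.mem_sigma, Finset.mem_Icc, Nat.mem_divisorsAntidiagonal] at h
          obtain ⟨⟨h1, h2⟩, rfl, h3⟩ := h
          have hn : 0 < n := by by_contra h; simp_all
          have he : 0 < e := by by_contra h; simp_all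
          simp only [Finset.mem_filter, Finset.mem_product, Finset.mem_Icc]
          refine ⟨⟨⟨hn, ?_⟩, he, ?_⟩, h2⟩ <;> nlinarith
        · rintro ⟨n, e⟩ h
          simp only [Finset.mem_filter, Finset.mem_product, Finset.mem_Icc] at h
          obtain ⟨⟨⟨h1, h2⟩, h3, h4⟩, h5⟩ := h
          simp only [Finset.mem_sigma, Finset.mem_Icc, Nat.mem_divisorsAntidiagonal]
          have : 0 < n * e := Nat.mul_pos h1 h3
          exact ⟨⟨this, h5⟩, trivial, this.ne'⟩
        · rintro ⟨j, n, e⟩ h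
          simp only [Finset.mem_sigma, Nat.mem_divisorsAntidiagonal] at h
          obtain ⟨_, rfl, _⟩ := h
          rfl
        · intros; rfl
        · rintro ⟨j, n, e⟩ h
          simp only [Finset.mem_sigma, Nat.mem_divisorsAntidiagonal] at h
          obtain ⟨_, rfl, _⟩ := h
          rfl

end Newton

/-! ### The Hasse–Davenport relation, from an L-function that is a polynomial of degree at most 1.
-/

section HasseDavenport

open Polynomial

/-- On `K(α)` the characteristic polynomial of multiplication by `α` is its minimal polynomial; the
remaining extension, of degree `e`, contributes the power. -/
theorem Algebra.norm_algebraMap_sub_eq_eval_minpoly_pow {K F : Type*} [Field K] [Field F]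
    [Algebra K F] [FiniteDimensional K F] (α : F) (a : K) {e : ℕ}
    (he : (minpoly K α).natDegree * e = Module.finrank K F) :
    Algebra.norm K (algebraMap K F a - α) = (minpoly K α).eval a ^ e := by
  have hint : IsIntegral K α := Algebra.IsIntegral.isIntegral α
  let pb := IntermediateField.adjoin.powerBasis hint
  have hdim : Module.finrank K (IntermediateField.adjoin K {α}) = (minpoly K α).natDegree :=
    IntermediateField.adjoin.finrank hint
  have hfin : Module.finrank (IntermediateField.adjoin K {α}) F = e := by
    have h := Module.finrank_mul_finrank K (IntermediateField.adjoin K {α}) F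
    rw [hdim, ← he] at h
    exact Nat.eq_of_mul_eq_mul_left (minpoly.natDegree_pos hint) h
  have hgen : pb.gen = IntermediateField.AdjoinSimple.gen K α := rfl
  have hα : algebraMap K F a - α = algebraMap (IntermediateField.adjoin K {α}) F
      (algebraMap K _ a - pb.gen) := by
    rw [map_sub, hgen, IntermediateField.AdjoinSimple.algebraMap_gen]
    rfl
  rw [hα, ← Algebra.norm_norm (S := IntermediateField.adjoin K {α}), Algebra.norm_algebraMap,
    map_pow, hfin, Algebra.norm_eq_matrix_det pb.basis, map_sub]
  congr 1
  have h1 : Algebra.leftMulMatrix pb.basis (algebraMap K _ a) = Matrix.scalar _ a := by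
    rw [AlgHom.commutes]
    rfl
  rw [h1, ← Matrix.eval_charpoly, charpoly_leftMulMatrix, hgen, IntermediateField.minpoly_gen]

variable {K F : Type*} [Field K] [Fintype K] [Field F] [Fintype F] [Algebra K F]
  {R : Type*} [CommRing R]

-- Since its degree divides `[F : K]`, `P` divides `X ^ |F| - X` and so splits in `F`; it is
-- separable because `K` is perfect.
open Classical in
theorem card_filter_minpoly_eq {P : K[X]} (hm : P.Monic) (hi : Irreducible P)
    (hd : P.natDegree ∣ Module.finrank K F) :
    (Finset.univ.filter fun α : F => minpoly K α = P).card = P.natDegree := by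
  have hdvd := hi.natDegree_dvd_iff_dvd_X_pow_card_pow_sub_X.1 hd
  rw [Nat.card_eq_fintype_card, ← Module.card_eq_pow_finrank] at hdvd
  have hsplit : (P.map (algebraMap K F)).Splits := by
    refine Splits.of_dvd ?_ ?_ (Polynomial.map_dvd (algebraMap K F) hdvd)
    · exact (FiniteField.isSplittingField_sub F K).splits
    · simpa using FiniteField.X_pow_card_sub_X_ne_zero F Fintype.one_lt_card
  rw [← card_rootSet_eq_natDegree (PerfectField.separable_of_irreducible hi) hsplit,
    ← Set.toFinset_card]
  congr 1
  ext α
  simp only [Finset.mem_filter, Finset.mem_univ, true_and, Set.mem_toFinset,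
    mem_rootSet_of_ne hm.ne_zero]
  refine ⟨?_, fun h => (minpoly.eq_of_irreducible_of_monic hi h hm).symm⟩
  rintro rfl
  exact minpoly.aeval K α

/-- Grouping `F` by minimal polynomial, each `P` of degree `n` dividing `[F : K]` occurs `n` times,
which is the weight in `primePowerSum`. -/
theorem primePowerSum_finrank (c : K[X] →* R) :
    primePowerSum c (Module.finrank K F) = ∑ α : F,
      c (minpoly K α) ^ (Module.finrank K F / (minpoly K α).natDegree) := by
  classical
  have : FiniteDimensional K F := Module.Finite.of_finite
  have hk : Module.finrank K F ≠ 0 := Module.finrank_pos.ne'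
  have hint (α : F) : IsIntegral K α := Algebra.IsIntegral.isIntegral α
  rw [primePowerSum, Finset.sum_sigma']
  symm
  rw [← Finset.sum_fiberwise_of_maps_to (g := fun α : F =>
    (⟨((minpoly K α).natDegree, Module.finrank K F / (minpoly K α).natDegree), minpoly K α⟩ :
      Σ _ : ℕ × ℕ, K[X]))]
  · refine Finset.sum_congr rfl ?_
    rintro ⟨⟨n, e⟩, P⟩ h
    simp only [Finset.mem_sigma, Nat.mem_divisorsAntidiagonal, mem_irreduciblesOfDegree] at h
    obtain ⟨⟨h1, _⟩, ⟨hm, rfl⟩, hi⟩ := h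
    have he : Module.finrank K F / P.natDegree = e := by
      rw [← h1, Nat.mul_div_cancel_left _ hi.natDegree_pos]
    trans ∑ α ∈ Finset.univ.filter (fun α : F => minpoly K α = P), c P ^ e
    swap
    · rw [Finset.sum_const, card_filter_minpoly_eq hm hi ⟨e, h1.symm⟩, nsmul_eq_mul]
    refine Finset.sum_congr ?_ ?_
    · ext α
      simp only [Finset.mem_filter, Finset.mem_univ, true_and, Sigma.mk.injEq, heq_eq_eq,
        Prod.mk.injEq]
      refine ⟨fun h => h.2, ?_⟩
      intro h
      exact ⟨⟨h ▸ rfl, h ▸ he⟩, h⟩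
    · intro α hα
      rw [(Finset.mem_filter.1 hα).2, he]
  · intro α _
    have hd : (minpoly K α).natDegree ∣ Module.finrank K F := minpoly.degree_dvd (hint α)
    simp only [Finset.mem_sigma, Nat.mem_divisorsAntidiagonal, mem_irreduciblesOfDegree]
    exact ⟨⟨Nat.mul_div_cancel' hd, hk⟩, ⟨minpoly.monic (hint α), trivial⟩,
      minpoly.irreducible (hint α)⟩

/-- The completely multiplicative function `f ↦ χ (f 0) * φ (f 1)`. -/
noncomputable def evalZeroOneHom (χ φ : MulChar K R) : K[X] →* R where
  toFun f := χ (f.eval 0) * φ (f.eval 1)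
  map_one' := by simp
  map_mul' f g := by
    simp only [eval_mul, map_mul]
    ring

omit [Fintype K] in
theorem evalZeroOneHom_apply (χ φ : MulChar K R) (f : K[X]) :
    evalZeroOneHom χ φ f = χ (f.eval 0) * φ (f.eval 1) := rfl

theorem sum_evalZeroOneHom_monicsOfDegree_one (χ φ : MulChar K R) (hχ : χ (-1) = 1) :
    ∑ f ∈ monicsOfDegree K 1, evalZeroOneHom χ φ f = jacobiSum χ φ := by
  -- `X - a` takes the values `-a` at 0 and `1 - a` at 1; the sign disappears since `χ (-1) = 1`.
  rw [sum_monicsOfDegree_one, jacobiSum, ← Equiv.sum_comp (Equiv.neg K)]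
  refine Finset.sum_congr rfl fun a _ => ?_
  rw [evalZeroOneHom_apply]
  simp only [Equiv.neg_apply, eval_add, eval_X, eval_C, ← sub_eq_add_neg]
  rw [zero_sub, ← neg_one_mul, map_mul, hχ, one_mul]

/-- Adding `(u - 1) f(0) (1 - X)` multiplies `f(0)` by `u`, keeps `f(1)`, and permutes the monic
polynomials of degree `d ≥ 2`. Thus the sum equals `χ u ≠ 1` times itself. -/
theorem sum_evalZeroOneHom_monicsOfDegree_eq_zero [IsDomain R] {χ : MulChar K R} (hχ : χ ≠ 1)
    (φ : MulChar K R) {d : ℕ} (hd : 2 ≤ d) :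
    ∑ f ∈ monicsOfDegree K d, evalZeroOneHom χ φ f = 0 := by
  obtain ⟨u, hu⟩ := MulChar.ne_one_iff.1 hχ
  refine eq_zero_of_mul_eq_self_left hu ?_
  have hdeg (b : K) (f : K[X]) (hf : f ∈ monicsOfDegree K d) :
      f + C b * (1 - X) ∈ monicsOfDegree K d := by
    obtain ⟨h1, h2⟩ := mem_monicsOfDegree.1 hf
    have h3 : (C b * (1 - X)).degree < f.degree := by
      rw [degree_eq_natDegree h1.ne_zero, h2]
      refine lt_of_le_of_lt (b := (1 : WithBot ℕ)) ?_ (by exact_mod_cast hd)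
      compute_degree
    refine mem_monicsOfDegree.2 ⟨h1.add_of_left h3, ?_⟩
    rw [natDegree_add_eq_left_of_degree_lt h3, h2]
  rw [Finset.mul_sum]
  refine Finset.sum_bij' (fun f _ => f + C ((u - 1) * f.eval 0) * (1 - X))
    (fun f _ => f + C (((u⁻¹ : Kˣ) - 1) * f.eval 0) * (1 - X)) ?_ ?_ ?_ ?_ ?_
  · exact fun f hf => hdeg _ f hf
  · exact fun f hf => hdeg _ f hf
  · intro f _
    simp only [eval_add, eval_mul, eval_C, eval_sub, eval_one, eval_X, sub_zero, mul_one]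
    rw [add_assoc, ← add_mul, ← C_add]
    have : (u - 1) * eval 0 f + ((u⁻¹ : Kˣ) - 1) * (eval 0 f + (u - 1) * eval 0 f) = 0 := by
      linear_combination eval 0 f * u.inv_mul
    rw [this]
    simp
  · intro f _
    simp only [eval_add, eval_mul, eval_C, eval_sub, eval_one, eval_X, sub_zero, mul_one]
    rw [add_assoc, ← add_mul, ← C_add]
    have : ((u⁻¹ : Kˣ) - 1) * eval 0 f + (u - 1) * (eval 0 f + ((u⁻¹ : Kˣ) - 1) * eval 0 f) = 0 := by
      linear_combination eval 0 f * u.inv_mul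
    rw [this]
    simp
  · intro f _
    simp only [evalZeroOneHom_apply, eval_add, eval_mul, eval_C, eval_sub, eval_one, eval_X,
      sub_zero, mul_one, sub_self, mul_zero, add_zero]
    rw [← mul_assoc, ← map_mul]
    congr 2
    ring

/-- The L-function is `1 + J T`, so Newton's identity becomes the recursion `p_(j+1) = -J p_j` with
`p_1 = J`. -/
theorem primePowerSum_evalZeroOneHom [IsDomain R] {χ : MulChar K R} (hχ : χ ≠ 1)
    (hχ' : χ (-1) = 1) (φ : MulChar K R) (d : ℕ) :
    primePowerSum (evalZeroOneHom χ φ) (d + 1) = -(-jacobiSum χ φ) ^ (d + 1) := by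
  have h0 : ∑ f ∈ monicsOfDegree K 0, evalZeroOneHom χ φ f = 1 := by
    rw [monicsOfDegree_zero, Finset.sum_singleton, map_one]
  have h1 := sum_evalZeroOneHom_monicsOfDegree_one χ φ hχ'
  induction d with
  | zero =>
    have h := sum_monicsOfDegree_newton (evalZeroOneHom χ φ) 1
    simp only [Finset.Icc_self, Finset.sum_singleton, Nat.sub_self, h0, h1] at h
    simpa using h.symm
  | succ d ih =>
    have h := sum_monicsOfDegree_newton (evalZeroOneHom χ φ) (d + 2)
    rw [sum_evalZeroOneHom_monicsOfDegree_eq_zero hχ φ (by omega), mul_zero,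
      Finset.sum_Icc_succ_top (by omega), Finset.sum_Icc_succ_top (by omega), Nat.sub_self, h0,
      show d + 2 - (d + 1) = 1 by omega, h1, ih, Finset.sum_eq_zero] at h
    · linear_combination -h
    · intro j hj
      rw [sum_evalZeroOneHom_monicsOfDegree_eq_zero hχ φ (by have := Finset.mem_Icc.1 hj; omega),
        mul_zero]

variable (F) in
/-- The composition of a multiplicative character with the norm. -/
noncomputable def MulChar.compNorm (χ : MulChar K R) : MulChar F R :=
  MulChar.ofUnitHom (χ.toUnitHom.comp (Units.map (Algebra.norm K (S := F))))

omit [Fintype K] [Fintype F] in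
theorem MulChar.compNorm_apply [FiniteDimensional K F] (χ : MulChar K R) (x : F) :
    χ.compNorm F x = χ (Algebra.norm K x) := by
  by_cases hx : x = 0
  · subst hx
    rw [Algebra.norm_zero, MulChar.map_nonunit _ not_isUnit_zero,
      MulChar.map_nonunit _ not_isUnit_zero]
  · lift x to Fˣ using isUnit_iff_ne_zero.2 hx
    simp [MulChar.compNorm]

/-- The Hasse–Davenport lifting relation for Jacobi sums. -/
theorem jacobiSum_compNorm [IsDomain R] {χ φ : MulChar K R} (hχ : χ ≠ 1) (hχ' : χ (-1) = 1) :
    jacobiSum (χ.compNorm F) (φ.compNorm F) = -(-jacobiSum χ φ) ^ Module.finrank K F := by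
  have : FiniteDimensional K F := Module.Finite.of_finite
  have hint (α : F) : IsIntegral K α := Algebra.IsIntegral.isIntegral α
  obtain ⟨d, hd⟩ := Nat.exists_eq_succ_of_ne_zero (Module.finrank_pos (R := K) (M := F)).ne'
  rw [hd, ← primePowerSum_evalZeroOneHom hχ hχ' φ, ← Nat.succ_eq_add_one, ← hd,
    primePowerSum_finrank, jacobiSum]
  refine Finset.sum_congr rfl fun α _ => ?_
  -- With this exponent the values of the minimal polynomial at 0 and 1 become the norms of `-α` and
  -- `1 - α`.
  have he := Nat.mul_div_cancel' (minpoly.degree_dvd (K := K) (hint α))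
  rw [evalZeroOneHom_apply, mul_pow, ← map_pow, ← map_pow,
    ← Algebra.norm_algebraMap_sub_eq_eval_minpoly_pow α 0 he,
    ← Algebra.norm_algebraMap_sub_eq_eval_minpoly_pow α 1 he, map_zero, map_one, zero_sub,
    ← MulChar.compNorm_apply, ← MulChar.compNorm_apply, ← neg_one_mul, map_mul]
  congr 1
  rw [MulChar.compNorm_apply (x := -1), show (-1 : F) = algebraMap K F (-1) by simp,
    Algebra.norm_algebraMap, map_pow, hχ', one_pow, one_mul]

end HasseDavenport

/-! ### Cubic characters, their Jacobi sums and the associated counts. -/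

section CubicCharacter

/-- Distinct cube roots of unity have product 1, and each pair contributes `-1`: `6 + 3 = 9`. If `u
= v`, that pair contributes 2 and the others `2 (x + x ^ 2)` with `x = u * v * w`, so everything
cancels. -/
theorem cubeRoots_distinct_indicator {R : Type*} [CommRing R] [IsDomain R] [DecidableEq R]
    {u v w : R} (hu : u ^ 3 = 1) (hv : v ^ 3 = 1) (hw : w ^ 3 = 1) :
    2 * (1 + u * v * w + (u * v * w) ^ 2) -
      (u * v ^ 2 + u ^ 2 * v + (u * w ^ 2 + u ^ 2 * w) + (v * w ^ 2 + v ^ 2 * w)) =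
      if u ≠ v ∧ u ≠ w ∧ v ≠ w then 9 else 0 := by
  split_ifs with h
  · obtain ⟨huv, huw, hvw⟩ := h
    have h1 : u ^ 2 + u * v + v ^ 2 = 0 := by
      refine (mul_eq_zero.1 ?_).resolve_left (sub_ne_zero.2 huv)
      linear_combination hu - hv
    have h2 : u ^ 2 + u * w + w ^ 2 = 0 := by
      refine (mul_eq_zero.1 ?_).resolve_left (sub_ne_zero.2 huw)
      linear_combination hu - hw
    have h3 : u + v + w = 0 := by
      refine (mul_eq_zero.1 ?_).resolve_left (sub_ne_zero.2 hvw)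
      linear_combination h1 - h2
    obtain rfl : w = -u - v := by linear_combination h3
    have h4 : u * v * (-u - v) = 1 := by linear_combination hu - u * h1
    have h5 : u * v ^ 2 + u ^ 2 * v = -1 := by linear_combination -h4
    rw [h4]
    linear_combination -3 * h5
  · have h' : u = v ∨ u = w ∨ v = w := by tauto
    rcases h' with rfl | rfl | rfl
    · linear_combination (2 * u * w ^ 2 - 2) * hu
    · linear_combination (2 * u * v ^ 2 - 2) * hu
    · linear_combination (2 * v * u ^ 2 - 2) * hv

variable {F : Type*} [Field F] {R : Type*} [CommRing R]

theorem MulChar.ne_one_of_orderOf_eq_three {χ : MulChar F R} (hχ : orderOf χ = 3) : χ ≠ 1 := by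
  rintro rfl
  simp at hχ

theorem MulChar.pow_three_of_orderOf_eq_three {χ : MulChar F R} (hχ : orderOf χ = 3) :
    χ ^ 3 = 1 := hχ ▸ pow_orderOf_eq_one χ

theorem MulChar.sq_eq_inv_of_orderOf_eq_three {χ : MulChar F R} (hχ : orderOf χ = 3) :
    χ ^ 2 = χ⁻¹ := by
  rw [eq_inv_iff_mul_eq_one, ← pow_succ, pow_three_of_orderOf_eq_three hχ]

theorem MulChar.map_neg_one_of_orderOf_eq_three {χ : MulChar F R} (hχ : orderOf χ = 3) :
    χ (-1) = 1 :=
  MulChar.val_neg_one_eq_one_of_odd_order (by decide : Odd 3) (pow_three_of_orderOf_eq_three hχ)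

theorem MulChar.apply_pow_three_of_orderOf_eq_three {χ : MulChar F R} (hχ : orderOf χ = 3)
    {x : F} (hx : x ≠ 0) : χ x ^ 3 = 1 := by
  rw [← MulChar.pow_apply' χ (by norm_num), pow_three_of_orderOf_eq_three hχ,
    MulChar.one_apply (isUnit_iff_ne_zero.2 hx)]

theorem MulChar.inv_apply_of_orderOf_eq_three {χ : MulChar F R} (hχ : orderOf χ = 3) (x : F) :
    χ⁻¹ x = χ x ^ 2 := by
  rw [← sq_eq_inv_of_orderOf_eq_three hχ, MulChar.pow_apply' χ (by norm_num)]

variable [Fintype F] [IsDomain R]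

theorem jacobiSum_inv_of_orderOf_eq_three {χ : MulChar F R} (hχ : orderOf χ = 3) :
    jacobiSum χ χ⁻¹ = -1 := by
  rw [jacobiSum_nontrivial_inv (MulChar.ne_one_of_orderOf_eq_three hχ),
    MulChar.map_neg_one_of_orderOf_eq_three hχ]

open Classical in
/-- The number of `t` for which `χ t`, `c * χ (1 - t)` and `c ^ 2` are distinct cube roots
of unity. -/
theorem nine_mul_card_distinct {χ : MulChar F R} (hχ : orderOf χ = 3) {c : R} (hc : c ^ 3 = 1) :
    9 * ((Finset.univ.filter fun t : F => (t ≠ 0 ∧ 1 - t ≠ 0) ∧ χ t ≠ c * χ (1 - t) ∧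
      χ t ≠ c ^ 2 ∧ c * χ (1 - t) ≠ c ^ 2).card : R) =
      2 * (Fintype.card F - 2 + (jacobiSum χ χ + jacobiSum χ⁻¹ χ⁻¹)) + 3 * (c + c ^ 2) := by
  have hχ1 := MulChar.ne_one_of_orderOf_eq_three hχ
  have hi := MulChar.inv_apply_of_orderOf_eq_three hχ
  -- The trivial character stands for the constant 1, so that every term vanishes at `t = 0` or `t =
  -- 1`.
  have key : ∀ t : F, (if (t ≠ 0 ∧ 1 - t ≠ 0) ∧ χ t ≠ c * χ (1 - t) ∧
      χ t ≠ c ^ 2 ∧ c * χ (1 - t) ≠ c ^ 2 then (9 : R) else 0) =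
      2 * ((1 : MulChar F R) t * (1 : MulChar F R) (1 - t) + χ t * χ (1 - t) +
        χ⁻¹ t * χ⁻¹ (1 - t)) - (c ^ 2 * (χ t * χ⁻¹ (1 - t)) + c * (χ⁻¹ t * χ (1 - t)) +
        (c * (χ t * (1 : MulChar F R) (1 - t)) + c ^ 2 * (χ⁻¹ t * (1 : MulChar F R) (1 - t))) +
        (c ^ 2 * ((1 : MulChar F R) t * χ (1 - t)) + c * ((1 : MulChar F R) t * χ⁻¹ (1 - t)))) := by
    intro t
    by_cases h0 : t = 0
    · subst h0; simp [MulChar.map_zero]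
    by_cases h1 : 1 - t = 0
    · rw [h1]; simp [MulChar.map_zero]
    have hu := MulChar.apply_pow_three_of_orderOf_eq_three hχ h0
    have hv := MulChar.apply_pow_three_of_orderOf_eq_three hχ h1
    have h := cubeRoots_distinct_indicator (u := χ t) (v := c * χ (1 - t)) (w := c ^ 2) hu
      (by rw [mul_pow, hc, hv, one_mul]) (by rw [← pow_mul, mul_comm, pow_mul, hc, one_pow])
    simp only [h0, h1, ne_eq, not_false_eq_true, true_and] at h ⊢
    rw [← h, hi, hi, MulChar.one_apply (isUnit_iff_ne_zero.2 h0),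
      MulChar.one_apply (isUnit_iff_ne_zero.2 h1)]
    generalize χ t = u at *
    generalize χ (1 - t) = v at *
    linear_combination (2 * u * v + 2 * u ^ 2 * v ^ 2 * (c ^ 3 + 1) - c * u - c * v ^ 2
      - c ^ 2 * v) * hc
  rw [← nsmul_eq_mul', ← Finset.sum_const, Finset.sum_filter, Finset.sum_congr rfl fun t _ => key t]
  simp only [Finset.sum_sub_distrib, Finset.sum_add_distrib, ← Finset.mul_sum]
  have e (φ ψ : MulChar F R) : ∑ t, φ t * ψ (1 - t) = jacobiSum φ ψ := rfl
  simp only [e]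
  rw [jacobiSum_comm χ⁻¹ χ, jacobiSum_comm χ 1, jacobiSum_comm χ⁻¹ 1,
    jacobiSum_inv_of_orderOf_eq_three hχ, jacobiSum_one_nontrivial hχ1,
    jacobiSum_one_nontrivial (inv_ne_one.2 hχ1), jacobiSum_one_one]
  ring

omit [IsDomain R] in
/-- A generator of the unit group relates a cubic character to the `(q - 1) / 3`-th power map. -/
theorem MulChar.exists_generator_of_orderOf_eq_three {χ : MulChar F R} (hχ : orderOf χ = 3) {s : ℕ}
    (hs : Fintype.card F = 3 * s + 1) :
    ∃ g : F, g ≠ 0 ∧ (∀ x : F, x ≠ 0 → ∃ i : ℕ, x = g ^ i) ∧ IsPrimitiveRoot (g ^ s) 3 ∧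
      IsPrimitiveRoot (χ g) 3 := by
  classical
  obtain ⟨g, hg⟩ := IsCyclic.exists_generator (α := Fˣ)
  have hord : orderOf g = 3 * s := by
    rw [orderOf_eq_card_of_forall_mem_zpowers hg, Nat.card_eq_fintype_card,
      Fintype.card_units, hs, Nat.add_sub_cancel]
  have hs0 : 0 < s := by
    have := Fintype.one_lt_card (α := F)
    omega
  refine ⟨g, g.ne_zero, ?_, ?_, ?_⟩
  · intro x hx
    obtain ⟨i, hi⟩ := (mem_powers_iff_mem_zpowers).2 (hg (Units.mk0 x hx))
    refine ⟨i, ?_⟩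
    simpa [Units.ext_iff] using hi.symm
  · have h := (IsPrimitiveRoot.orderOf g).pow (n := orderOf g) (a := s) (b := 3)
      (_root_.orderOf_pos g) (by rw [hord, mul_comm])
    have := IsPrimitiveRoot.coe_units_iff.2 h
    simpa using this
  · rw [IsPrimitiveRoot.iff_orderOf]
    refine orderOf_eq_prime (apply_pow_three_of_orderOf_eq_three hχ g.ne_zero) fun h => ?_
    exact ne_one_of_orderOf_eq_three hχ ((MulChar.eq_iff hg χ 1).2 (by simp [h]))

open Classical in
theorem MulChar.one_add_add_inv_eq_ite {χ : MulChar F R} (hχ : orderOf χ = 3) {s : ℕ}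
    (hs : Fintype.card F = 3 * s + 1) (t : F) :
    (1 : MulChar F R) t + χ t + χ⁻¹ t = if t ^ s = 1 then 3 else 0 := by
  have hs0 : s ≠ 0 := by
    have := Fintype.one_lt_card (α := F)
    omega
  rcases eq_or_ne t 0 with rfl | ht
  · simp [hs0]
  obtain ⟨g, -, hg, hζ, hω⟩ := exists_generator_of_orderOf_eq_three hχ hs
  obtain ⟨i, hi⟩ := hg t ht
  have h1 : t ^ s = 1 ↔ χ t = 1 := by
    rw [hi, map_pow, ← pow_mul, mul_comm, pow_mul, hζ.pow_eq_one_iff_dvd, hω.pow_eq_one_iff_dvd]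
  rw [inv_apply_of_orderOf_eq_three hχ, MulChar.one_apply (isUnit_iff_ne_zero.2 ht)]
  split_ifs with h
  · rw [h1.1 h]
    norm_num
  · refine (mul_eq_zero.1 ?_).resolve_left (sub_ne_zero.2 fun h' => h (h1.2 h'))
    linear_combination apply_pow_three_of_orderOf_eq_three hχ ht

open Classical in
/-- The number of `t` such that `t` and `1 - t` are both nonzero cubes. -/
noncomputable def cubePairCount (F : Type*) [Field F] [Fintype F] (s : ℕ) : ℕ :=
  (Finset.univ.filter fun t : F => t ^ s = 1 ∧ (1 - t) ^ s = 1).card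

/-- The general target `R` matters: `R = ℂ` shows that `J + J̄` is an integer, while `R = F`
computes the same count modulo the characteristic. -/
theorem nine_mul_cubePairCount {χ : MulChar F R} (hχ : orderOf χ = 3) {s : ℕ}
    (hs : Fintype.card F = 3 * s + 1) :
    9 * (cubePairCount F s : R) =
      Fintype.card F - 8 + (jacobiSum χ χ + jacobiSum χ⁻¹ χ⁻¹) := by
  classical
  have hχ1 := MulChar.ne_one_of_orderOf_eq_three hχ
  have key : ∀ t : F, (if t ^ s = 1 ∧ (1 - t) ^ s = 1 then (9 : R) else 0) =
      ((1 : MulChar F R) t + χ t + χ⁻¹ t) *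
        ((1 : MulChar F R) (1 - t) + χ (1 - t) + χ⁻¹ (1 - t)) := by
    intro t
    rw [MulChar.one_add_add_inv_eq_ite hχ hs, MulChar.one_add_add_inv_eq_ite hχ hs, ite_and]
    split_ifs <;> norm_num
  rw [cubePairCount, ← nsmul_eq_mul', ← Finset.sum_const, Finset.sum_filter,
    Finset.sum_congr rfl fun t _ => by convert key t]
  simp only [add_mul, mul_add, Finset.sum_add_distrib]
  have e (φ ψ : MulChar F R) : ∑ t, φ t * ψ (1 - t) = jacobiSum φ ψ := rfl
  simp only [e]
  rw [jacobiSum_comm χ⁻¹ χ, jacobiSum_comm χ 1, jacobiSum_comm χ⁻¹ 1,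
    jacobiSum_inv_of_orderOf_eq_three hχ, jacobiSum_one_nontrivial hχ1,
    jacobiSum_one_nontrivial (inv_ne_one.2 hχ1), jacobiSum_one_one]
  ring

theorem jacobiSum_mul_conj {χ : MulChar F ℂ} (hχ : orderOf χ = 3) :
    jacobiSum χ χ * (starRingEnd ℂ) (jacobiSum χ χ) = Fintype.card F ∧
      (starRingEnd ℂ) (jacobiSum χ χ) = jacobiSum χ⁻¹ χ⁻¹ := by
  have hconj : (starRingEnd ℂ) (jacobiSum χ χ) = jacobiSum χ⁻¹ χ⁻¹ := by
    simp only [jacobiSum, map_sum, map_mul, starRingEnd_apply, MulChar.star_apply']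
  refine ⟨?_, hconj⟩
  have hχ1 := MulChar.ne_one_of_orderOf_eq_three hχ
  rw [hconj]
  refine jacobiSum_mul_jacobiSum_inv ?_ hχ1 hχ1 ?_
  · rw [ringChar.eq ℂ 0]
    exact (CharP.ringChar_ne_zero_of_finite F).symm
  · rw [← sq, MulChar.sq_eq_inv_of_orderOf_eq_three hχ]
    exact inv_ne_one.2 hχ1

end CubicCharacter

/-! ### From permutation binomials to triples of distinct cube roots of unity. -/

section Binomial

open Polynomial

variable {F : Type*} [Field F] [Fintype F]

theorem IsPrimitiveRoot.pow_eq_pow_iff_modEq {M : Type*} [CommMonoid M] {ζ : M} {k a b : ℕ}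
    [NeZero k] (hζ : IsPrimitiveRoot ζ k) : ζ ^ a = ζ ^ b ↔ a ≡ b [MOD k] := by
  have hk : 0 < k := Nat.pos_of_ne_zero (NeZero.ne k)
  rw [← pow_mod_orderOf ζ a, ← pow_mod_orderOf ζ b, ← hζ.eq_orderOf]
  exact ⟨hζ.pow_inj (Nat.mod_lt _ hk) (Nat.mod_lt _ hk), fun h => by rw [h]⟩

/-- The criterion for `x ^ n * (x ^ s + a)` to permute a field with `3 * s + 1` elements. -/
theorem isPermutationPolynomial_binomial_iff {s n : ℕ} (hs : Fintype.card F = 3 * s + 1)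
    (hn : 0 < n) (hgcd : Nat.gcd n s = 1) {g : F} (hg0 : g ≠ 0) (hζ : IsPrimitiveRoot (g ^ s) 3)
    (a : F) :
    IsPermutationPolynomial (X ^ n * (X ^ s + C a)) ↔ (∀ i < 3, (g ^ s) ^ i + a ≠ 0) ∧
      Set.InjOn (fun i : ℕ => ((g ^ s) ^ i) ^ n * ((g ^ s) ^ i + a) ^ s)
        (Finset.range 3 : Finset ℕ) := by
  classical
  have heval (x : F) : (X ^ n * (X ^ s + C a)).eval x = x ^ n * (x ^ s + a) := by simp
  simp only [IsPermutationPolynomial, heval]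
  have hroot (x : F) (hx : x ≠ 0) : ∃ i < 3, (g ^ s) ^ i = x ^ s := by
    refine hζ.eq_pow_of_pow_eq_one ?_
    rw [← pow_mul, mul_comm, ← Nat.add_sub_cancel (3 * s) 1, ← hs]
    exact FiniteField.pow_card_sub_one_eq_one x hx
  -- The map `x ↦ x ^ s` carries the binomial to `y ↦ y ^ n * (y + a) ^ s` on cube roots of unity.
  have hpow (x : F) : (x ^ n * (x ^ s + a)) ^ s = (x ^ s) ^ n * (x ^ s + a) ^ s := by
    rw [mul_pow]
    ring
  have hzero : (0 : F) ^ n * (0 ^ s + a) = 0 := by rw [zero_pow hn.ne', zero_mul]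
  constructor
  · intro hf
    constructor
    · intro i _ h
      refine pow_ne_zero i hg0 (hf.1 ?_)
      simp only
      rw [hzero, pow_right_comm g i s, h, mul_zero]
    -- Injectivity on a set of three elements follows from surjectivity onto the cube roots of
    -- unity, which the surjectivity of the binomial provides.
    · rw [← Finset.card_image_iff, Finset.card_range]
      have hcard : ((Finset.range 3).image fun i : ℕ => (g ^ s) ^ i).card = 3 := by
        rw [Finset.card_image_of_injOn, Finset.card_range]
        intro i hi j hj h
        exact hζ.pow_inj (by simpa using hi) (by simpa using hj) h
      refine le_antisymm (Finset.card_image_le.trans (by simp)) ?_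
      conv_lhs => rw [← hcard]
      refine Finset.card_le_card fun y hy => ?_
      obtain ⟨l, -, rfl⟩ := Finset.mem_image.1 hy
      obtain ⟨x, hx⟩ := hf.2 (g ^ l)
      have hx0 : x ≠ 0 := by
        rintro rfl
        simp only [hzero] at hx
        exact pow_ne_zero l hg0 hx.symm
      obtain ⟨i, hi, hxi⟩ := hroot x hx0
      refine Finset.mem_image.2 ⟨i, Finset.mem_range.2 hi, ?_⟩
      simp only at hx ⊢
      rw [hxi, ← hpow, hx, ← pow_mul, ← pow_mul, mul_comm]
  · rintro ⟨hne, hinj⟩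
    have hne' (x : F) (hx : x ≠ 0) : x ^ s + a ≠ 0 := by
      obtain ⟨i, hi, h⟩ := hroot x hx
      rw [← h]
      exact hne i hi
    refine Finite.injective_iff_bijective.1 fun x y hxy => ?_
    rcases eq_or_ne x 0 with rfl | hx
    · by_contra hy
      rw [hzero] at hxy
      exact mul_ne_zero (pow_ne_zero n (Ne.symm hy)) (hne' y (Ne.symm hy)) hxy.symm
    rcases eq_or_ne y 0 with rfl | hy
    · rw [hzero] at hxy
      exact absurd hxy (mul_ne_zero (pow_ne_zero n hx) (hne' x hx))
    have hs' : x ^ s = y ^ s := by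
      obtain ⟨i, hi, hxi⟩ := hroot x hx
      obtain ⟨j, hj, hyj⟩ := hroot y hy
      have h := congrArg (· ^ s) hxy
      simp only [hpow] at h
      rw [← hxi, ← hyj] at h
      have hij : i = j := hinj (by simpa using hi) (by simpa using hj) h
      rw [← hxi, ← hyj, hij]
    have hn' : x ^ n = y ^ n := by
      rw [hs'] at hxy
      exact mul_right_cancel₀ (hne' y hy) hxy
    have h1 : (x / y) ^ Nat.gcd n s = 1 := by
      rw [pow_gcd_eq_one, div_pow, div_pow, hn', hs']
      exact ⟨div_self (pow_ne_zero _ hy), div_self (pow_ne_zero _ hy)⟩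
    rwa [hgcd, pow_one, div_eq_one_iff_eq hy] at h1

theorem injOn_range_three_iff {β : Type*} (f : ℕ → β) :
    Set.InjOn f (Finset.range 3 : Finset ℕ) ↔ f 0 ≠ f 1 ∧ f 0 ≠ f 2 ∧ f 1 ≠ f 2 := by
  constructor
  · intro h
    refine ⟨fun e => ?_, fun e => ?_, fun e => ?_⟩ <;>
      have := h (by simp) (by simp) e <;> omega
  · rintro ⟨h1, h2, h3⟩ i hi j hj e
    simp only [Finset.coe_range, Set.mem_Iio] at hi hj
    interval_cases i <;> interval_cases j <;> first | rfl | exact absurd e ‹_› | exact absurd e.symm ‹_›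

open Classical in
/-- The number of permutation binomials in terms of the number of triples of distinct cube
roots of unity. -/
theorem ncard_isPermutationPolynomial_binomial {s n : ℕ} (hs : Fintype.card F = 3 * s + 1)
    (hn : 0 < n) (hgcd : Nat.gcd n s = 1) {χ : MulChar F ℂ} (hχ : orderOf χ = 3) :
    ∃ ω : ℂ, IsPrimitiveRoot ω 3 ∧
      ((Set.ncard {a : F | IsPermutationPolynomial (X ^ n * (X ^ s + C a))} : ℂ) =
        (Finset.univ.filter fun t : F => (t ≠ 0 ∧ 1 - t ≠ 0) ∧
          χ t ≠ ω ^ (n + 2 * s) * χ (1 - t) ∧ χ t ≠ (ω ^ (n + 2 * s)) ^ 2 ∧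
            ω ^ (n + 2 * s) * χ (1 - t) ≠ (ω ^ (n + 2 * s)) ^ 2).card -
          if 3 ∣ n then 0 else 1) := by
  obtain ⟨g, hg0, hg, hζ, hω⟩ := MulChar.exists_generator_of_orderOf_eq_three hχ hs
  refine ⟨χ g, hω, ?_⟩
  have hχζ : χ (g ^ s) = χ g ^ s := map_pow χ g s
  -- Both sides compare exponents of the generator `g` mod 3, once through `g ^ s` and once through
  -- `χ g`.
  have htrans (x y : F) (hx : x ≠ 0) (hy : y ≠ 0) (i j : ℕ) :
      ((g ^ s) ^ i) ^ n * x ^ s = ((g ^ s) ^ j) ^ n * y ^ s ↔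
        χ g ^ (i * n) * χ x = χ g ^ (j * n) * χ y := by
    obtain ⟨k, rfl⟩ := hg x hx
    obtain ⟨l, rfl⟩ := hg y hy
    rw [map_pow, map_pow, ← pow_add, ← pow_add, hω.pow_eq_pow_iff_modEq,
      ← hζ.pow_eq_pow_iff_modEq]
    rw [pow_add, pow_add, pow_mul, pow_mul (g ^ s) j n, ← pow_mul g s k, ← pow_mul g s l,
      ← pow_mul g k s, ← pow_mul g l s, mul_comm s k, mul_comm s l]
  have hperm := isPermutationPolynomial_binomial_iff hs hn hgcd hg0 hζ
  generalize g ^ s = ζ at *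
  generalize χ g = ω at *
  set c := ω ^ (n + 2 * s) with hc
  have hζ3 : ζ ^ 3 = 1 := hζ.pow_eq_one
  have hω3 : ω ^ 3 = 1 := hω.pow_eq_one
  have hω0 : ω ≠ 0 := hω.ne_zero (by norm_num)
  have hζ0 : ζ ≠ 0 := hζ.ne_zero (by norm_num)
  have hζ1 : ζ ≠ 1 := hζ.ne_one (by norm_num)
  have hsum : ζ ^ 2 + ζ + 1 = 0 := by
    refine (mul_eq_zero.1 ?_).resolve_left (sub_ne_zero.2 hζ1)
    linear_combination hζ3
  have hωs : (ω ^ s) ^ 3 = 1 := by rw [← pow_mul, mul_comm, pow_mul, hω3, one_pow]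
  have hωn : (ω ^ n) ^ 3 = 1 := by rw [← pow_mul, mul_comm, pow_mul, hω3, one_pow]
  have hcs : c = ω ^ n * (ω ^ s) ^ 2 := by rw [hc]; ring
  have hneg (x : F) : χ (-x) = χ x := by
    rw [← neg_one_mul, map_mul, MulChar.map_neg_one_of_orderOf_eq_three hχ, one_mul]
  set T := Finset.univ.filter fun t : F => (t ≠ 0 ∧ 1 - t ≠ 0) ∧ χ t ≠ c * χ (1 - t) ∧
    χ t ≠ c ^ 2 ∧ c * χ (1 - t) ≠ c ^ 2 with hT
  have hmemT (t : F) : t ∈ T ↔ (t ≠ 0 ∧ 1 - t ≠ 0) ∧ χ t ≠ c * χ (1 - t) ∧ χ t ≠ c ^ 2 ∧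
      c * χ (1 - t) ≠ c ^ 2 := by simp [hT]
  have hcrit (a : F) : IsPermutationPolynomial (X ^ n * (X ^ s + C a)) ↔
      (1 + a ≠ 0 ∧ ζ + a ≠ 0 ∧ ζ ^ 2 + a ≠ 0) ∧
        (χ (1 + a) ≠ ω ^ n * χ (ζ + a) ∧ χ (1 + a) ≠ ω ^ (2 * n) * χ (ζ ^ 2 + a) ∧
          ω ^ n * χ (ζ + a) ≠ ω ^ (2 * n) * χ (ζ ^ 2 + a)) := by
    rw [hperm, injOn_range_three_iff]
    have hforall : (∀ i < 3, ζ ^ i + a ≠ 0) ↔ 1 + a ≠ 0 ∧ ζ + a ≠ 0 ∧ ζ ^ 2 + a ≠ 0 := by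
      simp [Nat.forall_lt_succ_right, and_assoc, Nat.le_one_iff_eq_zero_or_eq_one, or_imp, forall_and]
    rw [hforall]
    refine and_congr_right fun ⟨h0, h1, h2⟩ => ?_
    have e01 := htrans (1 + a) (ζ + a) h0 h1 0 1
    have e02 := htrans (1 + a) (ζ ^ 2 + a) h0 h2 0 2
    have e12 := htrans (ζ + a) (ζ ^ 2 + a) h1 h2 1 2
    simp only [pow_zero, pow_one, one_mul, zero_mul, one_pow] at e01 e02 e12 ⊢
    rw [Ne, e01, Ne, e02, Ne, e12]
  have hden (a : F) (h : ζ ^ 2 + a ≠ 0) : ζ + ζ ^ 2 * a ≠ 0 := by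
    have : ζ + ζ ^ 2 * a = ζ ^ 2 * (ζ ^ 2 + a) := by linear_combination -ζ * hζ3
    rw [this]
    exact mul_ne_zero (pow_ne_zero 2 hζ0) h
  have hden' (t : F) (h : t ≠ -ζ) : 1 + ζ ^ 2 * t ≠ 0 := by
    intro h'
    exact h (by linear_combination ζ * h' - t * hζ3)
  -- The Möbius map sends `-1, -ζ, -ζ²` to `0, 1, ∞`. The three values are divided by the common
  -- factor `χ (ζ + ζ ^ 2 * a)`, where `ζ + ζ ^ 2 * a = ζ ^ 2 * (ζ ^ 2 + a)`; this is where `c = ω ^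
  -- (n + 2 * s)` comes from.
  have hmobius (a : F) (h2 : ζ ^ 2 + a ≠ 0) :
      IsPermutationPolynomial (X ^ n * (X ^ s + C a)) ↔ -(1 + a) / (ζ + ζ ^ 2 * a) ∈ T := by
    have hd := hden a h2
    rw [hcrit, hmemT]
    have hone : 1 - -(1 + a) / (ζ + ζ ^ 2 * a) = -(ζ * (ζ + a)) / (ζ + ζ ^ 2 * a) := by
      rw [eq_div_iff hd, sub_mul, div_mul_cancel₀ _ hd]
      linear_combination (1 + a) * hsum
    have hD : χ (ζ + ζ ^ 2 * a) = (ω ^ s) ^ 2 * χ (ζ ^ 2 + a) := by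
      rw [← hχζ, ← map_pow, ← map_mul]
      congr 1
      linear_combination -ζ * hζ3
    have hD0 : χ (ζ + ζ ^ 2 * a) ≠ 0 := MulChar.apply_ne_zero_iff.2 (isUnit_iff_ne_zero.2 hd)
    have e0 : χ (1 + a) = χ (-(1 + a) / (ζ + ζ ^ 2 * a)) * χ (ζ + ζ ^ 2 * a) := by
      rw [← map_mul, div_mul_cancel₀ _ hd, hneg]
    have e1 : ω ^ n * χ (ζ + a) =
        c * χ (1 - -(1 + a) / (ζ + ζ ^ 2 * a)) * χ (ζ + ζ ^ 2 * a) := by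
      rw [mul_assoc, ← map_mul, hone, div_mul_cancel₀ _ hd, hneg, map_mul, hχζ, hcs]
      linear_combination -ω ^ n * χ (ζ + a) * hωs
    have e2 : ω ^ (2 * n) * χ (ζ ^ 2 + a) = c ^ 2 * χ (ζ + ζ ^ 2 * a) := by
      rw [hD, hcs]
      linear_combination -ω ^ (2 * n) * χ (ζ ^ 2 + a) * ((ω ^ s) ^ 3 + 1) * hωs
    have hcancel (x y : ℂ) : x * χ (ζ + ζ ^ 2 * a) ≠ y * χ (ζ + ζ ^ 2 * a) ↔ x ≠ y :=
      (mul_left_inj' hD0).not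
    rw [e0, e1, e2, hcancel, hcancel, hcancel, hone, div_ne_zero_iff, div_ne_zero_iff, neg_ne_zero, neg_ne_zero, mul_ne_zero_iff]
    simp only [ne_eq, h2, hd, hζ0, not_false_eq_true, and_true, true_and]
  -- The value `-ζ` is the image of `a = ∞`, hence of no `a` in the field.
  have hcard : {a : F | IsPermutationPolynomial (X ^ n * (X ^ s + C a))}.ncard =
      (T.erase (-ζ)).card := by
    rw [Set.ncard_eq_toFinset_card']
    have hinv (t : F) (h : t ≠ -ζ) : ζ ^ 2 + -(1 + ζ * t) / (1 + ζ ^ 2 * t) ≠ 0 ∧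
        -(1 + -(1 + ζ * t) / (1 + ζ ^ 2 * t)) / (ζ + ζ ^ 2 * (-(1 + ζ * t) / (1 + ζ ^ 2 * t))) =
          t := by
      have hd := hden' t h
      have h1 : ζ ^ 2 + -(1 + ζ * t) / (1 + ζ ^ 2 * t) ≠ 0 := by
        have : ζ ^ 2 + -(1 + ζ * t) / (1 + ζ ^ 2 * t) = (ζ ^ 2 - 1) / (1 + ζ ^ 2 * t) := by
          rw [eq_div_iff hd, add_mul, div_mul_cancel₀ _ hd]
          linear_combination ζ * t * hζ3
        rw [this]
        refine div_ne_zero (fun h0 => hζ1 ?_) hd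
        linear_combination hζ3 - ζ * h0
      refine ⟨h1, ?_⟩
      rw [div_eq_iff (hden _ h1)]
      have ha := div_mul_cancel₀ (-(1 + ζ * t)) hd
      linear_combination -ha
    have hne (a : F) (h2 : ζ ^ 2 + a ≠ 0) : -(1 + a) / (ζ + ζ ^ 2 * a) ≠ -ζ := by
      intro h
      rw [div_eq_iff (hden a h2)] at h
      have h' : ζ ^ 2 - 1 = 0 := by linear_combination h - a * hζ3
      exact hζ1 (by linear_combination hζ3 - ζ * h')
    refine Finset.card_bij' (fun a _ => -(1 + a) / (ζ + ζ ^ 2 * a))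
      (fun t _ => -(1 + ζ * t) / (1 + ζ ^ 2 * t)) ?_ ?_ ?_ ?_
    · intro a ha
      rw [Set.mem_toFinset, Set.mem_ofPred_eq] at ha
      have h2 := ((hcrit a).1 ha).1.2.2
      exact Finset.mem_erase.2 ⟨hne a h2, (hmobius a h2).1 ha⟩
    · intro t ht
      obtain ⟨h1, h2⟩ := hinv t (Finset.ne_of_mem_erase ht)
      rw [Set.mem_toFinset, Set.mem_ofPred_eq, hmobius _ h1, h2]
      exact Finset.mem_of_mem_erase ht
    · intro a ha
      rw [Set.mem_toFinset, Set.mem_ofPred_eq] at ha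
      have h2 := ((hcrit a).1 ha).1.2.2
      have ht := div_mul_cancel₀ (-(1 + a)) (hden a h2)
      rw [div_eq_iff (hden' _ (hne a h2))]
      linear_combination -ht
    · intro t ht
      exact (hinv t (Finset.ne_of_mem_erase ht)).2
  -- At `t = -ζ` the three values are `ω ^ s` times `1, ω ^ n, ω ^ (2 n)`.
  have hζT : -ζ ∈ T ↔ ¬ 3 ∣ n := by
    have hωs0 : ω ^ s ≠ 0 := pow_ne_zero _ hω0
    have e1 : c * χ (1 - -ζ) = ω ^ n * ω ^ s := by
      rw [show 1 - -ζ = -ζ ^ 2 by linear_combination hsum, hneg, map_pow, hχζ, hcs]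
      linear_combination ω ^ n * ω ^ s * hωs
    have e2 : c ^ 2 = (ω ^ n) ^ 2 * ω ^ s := by
      rw [hcs]
      linear_combination (ω ^ n) ^ 2 * ω ^ s * hωs
    have h1 : 1 - -ζ ≠ 0 := by
      rw [show 1 - -ζ = -ζ ^ 2 by linear_combination hsum]
      exact neg_ne_zero.2 (pow_ne_zero 2 hζ0)
    rw [hmemT, e1, e2, hneg, hχζ, ← hω.pow_eq_one_iff_dvd]
    refine ⟨fun h h' => h.2.1 (by rw [h', one_mul]), fun h => ⟨⟨neg_ne_zero.2 hζ0, h1⟩, ?_⟩⟩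
    refine ⟨fun e => h ?_, fun e => h ?_, fun e => h ?_⟩
    · exact mul_right_cancel₀ hωs0 (by rw [← e, one_mul])
    · have h' : (ω ^ n) ^ 2 = 1 := mul_right_cancel₀ hωs0 (by rw [← e, one_mul])
      linear_combination hωn - ω ^ n * h'
    · have h' := mul_right_cancel₀ hωs0 e
      exact mul_left_cancel₀ (pow_ne_zero n hω0) (by rw [mul_one, ← sq, ← h'])
  rw [hcard]
  split_ifs with h
  · rw [Finset.erase_eq_of_notMem (by rw [hζT]; exact not_not.2 h), sub_zero]
  · have := Finset.card_erase_add_one (hζT.2 h)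
    rw [← this]
    push_cast
    ring

end Binomial

/-! ### The integer `κ_p` as a cubic Jacobi sum over the prime field. -/

section Kappa

/-- This is `C(2m, m) = (-4) ^ m C(-1/2, m)`, since `3 * f = (p - 1) / 2` is `-1/2` mod `p`. The
induction may divide by `m + 1`, which is less than `p`. -/
theorem centralBinom_eq_neg_four_pow_mul_choose {p f : ℕ} [Fact p.Prime] (hp : p = 6 * f + 1) :
    ∀ m ≤ 3 * f, (Nat.centralBinom m : ZMod p) = (-4) ^ m * (Nat.choose (3 * f) m : ZMod p) := by
  have hp0 : (6 * f + 1 : ZMod p) = 0 := by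
    have h : ((6 * f + 1 : ℕ) : ZMod p) = 0 := (ZMod.natCast_eq_zero_iff _ _).2 (by rw [← hp])
    exact_mod_cast h
  intro m
  induction m with
  | zero => simp
  | succ m ih =>
    intro hm
    have hne : ((m + 1 : ℕ) : ZMod p) ≠ 0 := by
      rw [Ne, ZMod.natCast_eq_zero_iff]
      exact Nat.not_dvd_of_pos_of_lt (Nat.succ_pos m) (by omega)
    refine mul_left_cancel₀ hne ?_
    have h1 := congrArg (Nat.cast : ℕ → ZMod p) (Nat.succ_mul_centralBinom_succ m)
    have h2 := congrArg (Nat.cast : ℕ → ZMod p) (Nat.choose_succ_right_eq (3 * f) m)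
    rw [Nat.cast_mul, Nat.cast_mul, Nat.cast_sub (by omega)] at h2
    push_cast at h1 h2 ⊢
    rw [h1, ih (by omega)]
    linear_combination -(-4) ^ (m + 1) * h2 + 2 * (-4) ^ m * ((3 * f).choose m : ZMod p) * hp0

/-- The case `m = 2 * f` of the previous identity, with `4 ^ (3 f) = 2 ^ (p - 1) = 1`. -/
theorem choose_four_mul_eq {p f : ℕ} [Fact p.Prime] (hp : p = 6 * f + 1) (hf : 0 < f) :
    (Nat.choose (4 * f) (2 * f) : ZMod p) =
      (Nat.choose (3 * f) (2 * f) : ZMod p) * (4 : ZMod p)⁻¹ ^ f := by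
  have h := centralBinom_eq_neg_four_pow_mul_choose hp (2 * f) (by omega)
  rw [Nat.centralBinom, show 2 * (2 * f) = 4 * f by ring] at h
  have h2 : (2 : ZMod p) ≠ 0 := by
    have : ((2 : ℕ) : ZMod p) ≠ 0 := by
      rw [Ne, ZMod.natCast_eq_zero_iff]
      exact Nat.not_dvd_of_pos_of_lt (by norm_num) (by omega)
    exact_mod_cast this
  have h4 : (4 : ZMod p) ≠ 0 := by
    rw [show (4 : ZMod p) = 2 ^ 2 by norm_num]
    exact pow_ne_zero 2 h2
  have h64 : (2 : ZMod p) ^ (6 * f) = 1 := by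
    rw [← ZMod.pow_card_sub_one_eq_one h2]
    congr 1
    omega
  rw [h, mul_comm, inv_pow]
  congr 1
  refine eq_inv_of_mul_eq_one_left ?_
  rw [← h64, pow_mul, pow_mul, ← mul_pow]
  norm_num

theorem FiniteField.sum_pow_eq_ite {K : Type*} [Field K] [Fintype K] {i : ℕ} (hi : 0 < i) :
    ∑ x : K, x ^ i = if Fintype.card K - 1 ∣ i then -1 else 0 := by
  classical
  rw [← FiniteField.sum_pow_units K i, ← Finset.add_sum_erase _ _ (Finset.mem_univ (0 : K)),
    zero_pow hi.ne', zero_add]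
  symm
  refine Finset.sum_bij (fun x _ => (x : K)) ?_ ?_ ?_ ?_
  · exact fun x _ => Finset.mem_erase.2 ⟨x.ne_zero, Finset.mem_univ _⟩
  · exact fun x _ y _ h => Units.ext h
  · exact fun x hx => ⟨Units.mk0 x (Finset.ne_of_mem_erase hx), Finset.mem_univ _, rfl⟩
  · exact fun _ _ => rfl

theorem sum_pow_mul_one_sub_pow {K : Type*} [Field K] [Fintype K] {e : ℕ} (he : 0 < e) :
    ∑ x : K, x ^ e * (1 - x) ^ e = ∑ k ∈ Finset.range (e + 1),
      (-1) ^ k * (Nat.choose e k : K) * if Fintype.card K - 1 ∣ e + k then -1 else 0 := by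
  have h (x : K) : x ^ e * (1 - x) ^ e = ∑ k ∈ Finset.range (e + 1),
      (-1) ^ k * (Nat.choose e k : K) * x ^ (e + k) := by
    rw [sub_eq_neg_add, add_pow, Finset.mul_sum]
    refine Finset.sum_congr rfl fun k _ => ?_
    rw [one_pow, mul_one, neg_pow, pow_add]
    ring
  simp only [h]
  rw [Finset.sum_comm]
  refine Finset.sum_congr rfl fun k _ => ?_
  rw [← Finset.mul_sum, FiniteField.sum_pow_eq_ite (by omega)]

/-- The power map `x ↦ x ^ s` as a multiplicative character. -/
def powMulChar (K : Type*) [Field K] {s : ℕ} (hs : s ≠ 0) : MulChar K K where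
  toFun x := x ^ s
  map_one' := one_pow s
  map_mul' x y := mul_pow x y s
  map_nonunit' x hx := by
    rw [isUnit_iff_ne_zero, not_not] at hx
    rw [hx, zero_pow hs]

theorem powMulChar_apply {K : Type*} [Field K] {s : ℕ} (hs : s ≠ 0) (x : K) :
    powMulChar K hs x = x ^ s := rfl

theorem orderOf_powMulChar {K : Type*} [Field K] [Fintype K] {s : ℕ} (hs : s ≠ 0)
    (hK : Fintype.card K = 3 * s + 1) : orderOf (powMulChar K hs) = 3 := by
  have : Fact (Nat.Prime 3) := ⟨Nat.prime_three⟩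
  refine orderOf_eq_prime ?_ fun h => ?_
  · ext x
    rw [MulChar.pow_apply_coe, powMulChar_apply, MulChar.one_apply_coe, ← pow_mul, mul_comm,
      ← Nat.add_sub_cancel (3 * s) 1, ← hK]
    exact FiniteField.pow_card_sub_one_eq_one _ x.ne_zero
  · have h1 : ∀ x : Kˣ, x ^ s = 1 := by
      intro x
      ext
      rw [Units.val_pow_eq_pow_val, ← powMulChar_apply hs, h, MulChar.one_apply_coe, Units.val_one]
    have := Nat.le_of_dvd (Nat.pos_of_ne_zero hs) ((FiniteField.forall_pow_eq_one_iff K s).1 h1)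
    omega

/-- Take the cubic character `x ↦ x ^ s` with values in `K`. Its Jacobi sum vanishes because `x ^ s
(1 - x) ^ s` has degree below `q - 1`; for the inverse character the exponents run from `2 s` to `4
s`, and only `3 s = q - 1` contributes. -/
theorem nine_mul_cubePairCount_eq_choose {K : Type*} [Field K] [Fintype K] {s : ℕ}
    (hs : s ≠ 0) (hK : Fintype.card K = 3 * s + 1) :
    9 * (cubePairCount K s : K) = -8 - (-1) ^ s * (Nat.choose (2 * s) s : K) := by
  have hord := orderOf_powMulChar hs hK
  have h1 : jacobiSum (powMulChar K hs) (powMulChar K hs) = 0 := by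
    simp only [jacobiSum, powMulChar_apply]
    rw [sum_pow_mul_one_sub_pow (Nat.pos_of_ne_zero hs)]
    refine Finset.sum_eq_zero fun k hk => ?_
    rw [if_neg, mul_zero]
    rw [hK, Nat.add_sub_cancel]
    refine Nat.not_dvd_of_pos_of_lt (by omega) ?_
    have := Finset.mem_range.1 hk
    omega
  have h2 : jacobiSum (powMulChar K hs)⁻¹ (powMulChar K hs)⁻¹ =
      -((-1) ^ s * (Nat.choose (2 * s) s : K)) := by
    simp only [jacobiSum, MulChar.inv_apply_of_orderOf_eq_three hord, powMulChar_apply, ← pow_mul]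
    rw [mul_comm s 2, sum_pow_mul_one_sub_pow (by omega), Finset.sum_eq_single s]
    · rw [if_pos, mul_neg_one]
      rw [hK, Nat.add_sub_cancel]
      exact ⟨1, by ring⟩
    · intro k hk hks
      rw [if_neg, mul_zero]
      rw [hK, Nat.add_sub_cancel]
      rintro ⟨d, hd⟩
      have := Finset.mem_range.1 hk
      have hd2 : d < 2 := by
        by_contra h
        have : 3 * s * 2 ≤ 3 * s * d := Nat.mul_le_mul_left _ (by omega)
        omega
      interval_cases d <;> omega
    · intro h
      exact absurd (Finset.mem_range.2 (by omega)) h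
  rw [nine_mul_cubePairCount hord hK, h1, h2, FiniteField.cast_card_eq_zero]
  ring

/-- For `p = 7` and `p = 13` the congruence class is that of `1` and of `-5`, and it has a single
member within the bound. -/
theorem isKappa_of_sq_le {p f : ℕ} (hp : p = 6 * f + 1) (hf : 0 < f) {κ : ℤ} (hsq : κ ^ 2 ≤ 4 * p)
    (hmod : (κ : ZMod p) = -((Nat.choose ((p - 1) / 2) ((p - 1) / 3) : ℕ) : ZMod p) *
      (4 : ZMod p)⁻¹ ^ ((p - 1) / 6)) : IsKappa p κ := by
  by_cases h19 : 19 ≤ p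
  · refine Or.inr (Or.inr (Or.inl ⟨by omega, h19, ?_, hmod⟩))
    refine abs_le_of_sq_le_sq ?_ (by positivity)
    rw [mul_pow, Real.sq_sqrt (Nat.cast_nonneg p)]
    norm_num
    exact_mod_cast hsq
  obtain rfl | rfl : p = 7 ∨ p = 13 := by omega
  · refine Or.inl ⟨rfl, ?_⟩
    have h7 : (κ : ZMod 7) = ((1 : ℤ) : ZMod 7) := by
      rw [hmod, ZMod.inv_eq_of_mul_eq_one 7 4 2 (by decide)]
      decide
    have := (ZMod.intCast_eq_intCast_iff_dvd_sub _ _ 7).1 h7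
    norm_num at hsq
    have h1 : κ ≤ 5 := by nlinarith
    have h2 : -5 ≤ κ := by nlinarith
    omega
  · refine Or.inr (Or.inl ⟨rfl, ?_⟩)
    have h13 : (κ : ZMod 13) = ((-5 : ℤ) : ZMod 13) := by
      rw [hmod, ZMod.inv_eq_of_mul_eq_one 13 4 10 (by decide)]
      decide
    have := (ZMod.intCast_eq_intCast_iff_dvd_sub _ _ 13).1 h13
    norm_num at hsq
    have h1 : κ ≤ 7 := by nlinarith
    have h2 : -7 ≤ κ := by nlinarith
    omega

/-- For a prime `p ≡ 1 (mod 3)`, twice the real part of a cubic Jacobi sum is an integer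
satisfying the conditions that define `κ_p`. -/
theorem exists_isKappa_eq_jacobiSum {p : ℕ} [Fact p.Prime] (hp : p % 3 = 1)
    {χ : MulChar (ZMod p) ℂ} (hχ : orderOf χ = 3) :
    ∃ κ : ℤ, IsKappa p κ ∧
      (κ : ℂ) = jacobiSum χ χ + (starRingEnd ℂ) (jacobiSum χ χ) := by
  have hprime : p.Prime := Fact.out
  obtain ⟨f, hf⟩ : ∃ f, p = 6 * f + 1 := by
    have h2 : p % 2 = 1 := by
      rcases hprime.eq_two_or_odd with h | h
      · rw [h] at hp
        omega
      · exact h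
    exact ⟨p / 6, by omega⟩
  have hf0 : 0 < f := by
    have := hprime.one_lt
    omega
  have hcard : Fintype.card (ZMod p) = 3 * (2 * f) + 1 := by rw [ZMod.card]; omega
  obtain ⟨hnorm, hconj⟩ := jacobiSum_mul_conj hχ
  -- The value comes from solving `nine_mul_cubePairCount` for `J + J̄`; it is visibly an integer,
  -- and its residue follows from the same count in `ZMod p`.
  set κ : ℤ := 9 * cubePairCount (ZMod p) (2 * f) + 8 - p with hκ
  have hJ : (κ : ℂ) = jacobiSum χ χ + (starRingEnd ℂ) (jacobiSum χ χ) := by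
    have := nine_mul_cubePairCount hχ hcard
    rw [ZMod.card] at this
    rw [hκ]
    push_cast
    rw [this, hconj]
    ring
  refine ⟨κ, ?_, hJ⟩
  have hsq : κ ^ 2 ≤ 4 * p := by
    rw [ZMod.card, Complex.mul_conj] at hnorm
    rw [Complex.add_conj] at hJ
    have h1 : (κ : ℝ) = 2 * (jacobiSum χ χ).re := by exact_mod_cast hJ
    have h2 : Complex.normSq (jacobiSum χ χ) = p := by exact_mod_cast hnorm
    rw [Complex.normSq_apply] at h2
    have : (κ : ℝ) ^ 2 ≤ 4 * p := by
      rw [h1, ← h2]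
      nlinarith [mul_self_nonneg (jacobiSum χ χ).im]
    exact_mod_cast this
  have hmod : (κ : ZMod p) = -((Nat.choose ((p - 1) / 2) ((p - 1) / 3) : ℕ) : ZMod p) *
      (4 : ZMod p)⁻¹ ^ ((p - 1) / 6) := by
    have h := nine_mul_cubePairCount_eq_choose (by omega) hcard
    rw [show (p - 1) / 2 = 3 * f by omega, show (p - 1) / 3 = 2 * f by omega,
      show (p - 1) / 6 = f by omega, neg_mul, ← choose_four_mul_eq hf hf0, hκ]
    rw [show 2 * (2 * f) = 4 * f by ring, (even_two_mul f).neg_one_pow] at h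
    push_cast
    rw [h, ZMod.natCast_self]
    ring
  exact isKappa_of_sq_le hf hf0 hsq hmod

/-- Two congruent candidates differ by at most `4 √p`, which is less than `p` as soon as `p > 16`.
-/
theorem IsKappa.unique {p : ℕ} {κ κ' : ℤ} (h : IsKappa p κ) (h' : IsKappa p κ') : κ = κ' := by
  rcases h with h | h | ⟨h1, h2, h3, h4⟩ | h <;> rcases h' with h' | h' | ⟨h1', h2', h3', h4'⟩ | h' <;>
    try omega
  have hdvd : (p : ℤ) ∣ κ - κ' := by
    rw [← ZMod.intCast_eq_intCast_iff_dvd_sub, h4, h4']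
  have hlt : |κ - κ'| < p := by
    have h19 : (19 : ℝ) ≤ p := by exact_mod_cast h2
    have hs := Real.sq_sqrt (Nat.cast_nonneg (α := ℝ) p)
    have h : |(κ : ℝ) - κ'| < p := by
      refine (abs_sub _ _).trans_lt ((add_le_add h3 h3').trans_lt ?_)
      nlinarith [Real.sqrt_nonneg (p : ℝ)]
    exact_mod_cast h
  have := Int.eq_zero_of_abs_lt_dvd hdvd hlt
  omega

theorem existsUnique_isKappa {p : ℕ} (hp : p.Prime) (hp3 : p ≠ 3) : ∃! κ : ℤ, IsKappa p κ := by
  refine existsUnique_of_exists_of_unique ?_ fun _ _ h h' => h.unique h'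
  have hmod : p % 3 = 1 ∨ p % 3 = 2 := by
    have : ¬ 3 ∣ p := fun h => hp3 ((Nat.prime_dvd_prime_iff_eq Nat.prime_three hp).1 h).symm
    omega
  rcases hmod with h | h
  · have : Fact p.Prime := ⟨hp⟩
    obtain ⟨χ, hχ⟩ := MulChar.exists_mulChar_orderOf (ZMod p) (n := 3)
      (by rw [ZMod.card]; omega) (Complex.isPrimitiveRoot_exp 3 (by norm_num))
    obtain ⟨κ, hκ, -⟩ := exists_isKappa_eq_jacobiSum h hχ
    exact ⟨κ, hκ⟩
  · exact ⟨0, Or.inr (Or.inr (Or.inr ⟨h, rfl⟩))⟩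

theorem IsKappa.kappa_eq {p : ℕ} {κ : ℤ} (h : IsKappa p κ) : kappa p = κ := by
  have hex : ∃ κ : ℤ, IsKappa p κ := ⟨κ, h⟩
  rw [kappa, dif_pos hex]
  exact hex.choose_spec.unique h

/-- Both `-J` and `-J̄` have real part `-κ_p / 2` and squared modulus `p`, so they are `π_p` and its
conjugate, in an order given by the sign of `J.im`. -/
theorem piFrob_pow_add_conj {p : ℕ} (k : ℕ) {J : ℂ}
    (hJ : (kappa p : ℂ) = J + (starRingEnd ℂ) J) (hnorm : J * (starRingEnd ℂ) J = p) :
    piFrob p ^ k + (starRingEnd ℂ) (piFrob p) ^ k = (-J) ^ k + (-(starRingEnd ℂ) J) ^ k := by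
  rw [Complex.mul_conj] at hnorm
  rw [Complex.add_conj] at hJ
  have h1 : (kappa p : ℝ) = 2 * J.re := by exact_mod_cast hJ
  have h2 : Complex.normSq J = p := by exact_mod_cast hnorm
  rw [Complex.normSq_apply] at h2
  have hsqrt : Real.sqrt ((p : ℝ) - (kappa p : ℝ) ^ 2 / 4) = |J.im| := by
    rw [h1, ← h2, ← Real.sqrt_sq_eq_abs]
    congr 1
    ring
  have hpi : piFrob p = -J.re + Complex.I * (|J.im| : ℝ) := by
    rw [piFrob, hsqrt, hJ]
    push_cast
    ring
  rcases le_total 0 J.im with h | h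
  · have : piFrob p = -(starRingEnd ℂ) J := by
      rw [hpi, abs_of_nonneg h]
      apply Complex.ext <;> simp
    rw [this, map_neg, Complex.conj_conj, add_comm]
  · have : piFrob p = -J := by
      rw [hpi, abs_of_nonpos h]
      apply Complex.ext <;> simp
    rw [this, map_neg]

end Kappa

/-! ### The cubic Jacobi sum over the full field in terms of `π_p`, and `ε₁`. -/

section Count

variable {F : Type*} [Field F] [Fintype F]

theorem orderOf_compNorm {K : Type*} [Field K] [Fintype K] [Algebra K F] {R : Type*} [CommRing R]
    {χ : MulChar K R} (hχ : orderOf χ = 3) : orderOf (χ.compNorm F) = 3 := by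
  have : FiniteDimensional K F := Module.Finite.of_finite
  have : Fact (Nat.Prime 3) := ⟨Nat.prime_three⟩
  refine orderOf_eq_prime ?_ fun h => ?_
  · ext x
    rw [MulChar.pow_apply_coe, MulChar.compNorm_apply, MulChar.one_apply_coe]
    exact MulChar.apply_pow_three_of_orderOf_eq_three hχ
      ((Algebra.norm_ne_zero_iff).2 x.ne_zero)
  · refine MulChar.ne_one_of_orderOf_eq_three hχ ?_
    ext y
    obtain ⟨x, hx⟩ := FiniteField.unitsMap_norm_surjective K F y
    have := congrArg (fun φ : MulChar F R => φ x) h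
    simp only [MulChar.compNorm_apply, MulChar.one_apply_coe] at this
    rw [MulChar.one_apply_coe, ← this, ← hx]
    rfl

theorem exists_jacobiSum_eq_of_one_mod_three {p k : ℕ} [Fact p.Prime]
    (hF : Fintype.card F = p ^ k) (hp : p % 3 = 1) :
    ∃ χ : MulChar F ℂ, orderOf χ = 3 ∧
      jacobiSum χ χ + jacobiSum χ⁻¹ χ⁻¹ = -(piFrob p ^ k + (starRingEnd ℂ) (piFrob p) ^ k) := by
  have : CharP F p := charP_of_card_eq_prime_pow hF
  let _ : Algebra (ZMod p) F := ZMod.algebra F p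
  have hk : Module.finrank (ZMod p) F = k := by
    have h := Module.card_eq_pow_finrank (K := ZMod p) (V := F)
    rw [hF, ZMod.card] at h
    exact (Nat.pow_right_injective (Fact.out : p.Prime).two_le h).symm
  obtain ⟨χ, hχ⟩ := MulChar.exists_mulChar_orderOf (ZMod p) (n := 3)
    (by rw [ZMod.card]; omega) (Complex.isPrimitiveRoot_exp 3 (by norm_num))
  obtain ⟨κ, hκ, hJ⟩ := exists_isKappa_eq_jacobiSum hp hχ
  have hnorm := (jacobiSum_mul_conj hχ).1
  rw [ZMod.card] at hnorm
  rw [← hκ.kappa_eq] at hJ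
  have hχF := orderOf_compNorm (F := F) hχ
  refine ⟨χ.compNorm F, hχF, ?_⟩
  rw [← (jacobiSum_mul_conj hχF).2, jacobiSum_compNorm (MulChar.ne_one_of_orderOf_eq_three hχ)
    (MulChar.map_neg_one_of_orderOf_eq_three hχ), hk, piFrob_pow_add_conj k hJ hnorm]
  simp only [map_neg, map_pow]
  ring

/-- Frobenius permutes `F`, commutes with `x ↦ 1 - x`, and turns `χ` into `χ ^ 2 = χ⁻¹`. -/
theorem jacobiSum_inv_eq_of_two_mod_three {p : ℕ} [Fact p.Prime] [CharP F p] (hp : p % 3 = 2)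
    {χ : MulChar F ℂ} (hχ : orderOf χ = 3) : jacobiSum χ⁻¹ χ⁻¹ = jacobiSum χ χ := by
  have hfrob (x : F) : χ (x ^ p) = χ⁻¹ x := by
    rcases eq_or_ne x 0 with rfl | hx
    · rw [zero_pow (Fact.out : p.Prime).ne_zero, MulChar.map_zero, MulChar.map_zero]
    · rw [MulChar.inv_apply_of_orderOf_eq_three hχ, map_pow, ← Nat.div_add_mod p 3, pow_add,
        pow_mul, MulChar.apply_pow_three_of_orderOf_eq_three hχ hx, one_pow, one_mul, hp]
  have hbij : Function.Bijective (fun x : F => x ^ p) :=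
    Finite.injective_iff_bijective.1 (frobenius_inj F p)
  simp only [jacobiSum]
  rw [← hbij.sum_comp (fun x => χ x * χ (1 - x))]
  refine Finset.sum_congr rfl fun x _ => ?_
  rw [← hfrob, ← hfrob, sub_pow_char, one_pow]

/-- Here `k = 2 m` because `q ≡ 1 (mod 3)`, and `J` is real with `J ^ 2 = p ^ (2 m)`, so `J = ±(-p)
^ m`. As `-p ≡ 1 (mod 3)`, the plus sign would make nine times a count congruent to 1 mod 3. On the
other side, `π_p = i √p`. -/
theorem exists_jacobiSum_eq_of_two_mod_three {p k : ℕ} [Fact p.Prime]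
    (hF : Fintype.card F = p ^ k) (hp : p % 3 = 2) {s : ℕ} (hs : Fintype.card F = 3 * s + 1) :
    ∃ χ : MulChar F ℂ, orderOf χ = 3 ∧
      jacobiSum χ χ + jacobiSum χ⁻¹ χ⁻¹ = -(piFrob p ^ k + (starRingEnd ℂ) (piFrob p) ^ k) := by
  have : CharP F p := charP_of_card_eq_prime_pow hF
  have hkap : kappa p = 0 := IsKappa.kappa_eq (Or.inr (Or.inr (Or.inr ⟨hp, rfl⟩)))
  obtain ⟨χ, hχ⟩ := MulChar.exists_mulChar_orderOf F (n := 3)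
    (by rw [hs, Nat.add_sub_cancel]; exact dvd_mul_right 3 s)
    (Complex.isPrimitiveRoot_exp 3 (by norm_num))
  refine ⟨χ, hχ, ?_⟩
  have hp3 : (p : ZMod 3) = -1 := by
    rw [← Nat.div_add_mod p 3, hp]
    push_cast
    have : (3 : ZMod 3) = 0 := by decide
    rw [this, zero_mul, zero_add]
    decide
  obtain ⟨m, rfl⟩ : Even k := by
    by_contra hodd
    rw [Nat.not_even_iff_odd] at hodd
    have h := congrArg (Nat.cast : ℕ → ZMod 3) (hF.symm.trans hs)
    push_cast at h
    rw [hp3, hodd.neg_one_pow, show (3 : ZMod 3) = 0 by decide, zero_mul, zero_add] at h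
    exact absurd h (by decide)
  obtain ⟨hnorm, hconj⟩ := jacobiSum_mul_conj hχ
  have hreal := jacobiSum_inv_eq_of_two_mod_three (p := p) hp hχ
  have hcount := nine_mul_cubePairCount hχ hs
  rw [hconj, hreal, hF] at hnorm
  rw [hreal, hF] at hcount
  rw [hreal]
  set J := jacobiSum χ χ with hJ
  have hpi : piFrob p ^ (m + m) + (starRingEnd ℂ) (piFrob p) ^ (m + m) = 2 * (-p : ℂ) ^ m := by
    have h1 : piFrob p = Complex.I * (Real.sqrt p : ℂ) := by
      simp [piFrob, hkap]
    have h2 : piFrob p ^ 2 = -p := by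
      rw [h1, mul_pow, Complex.I_sq, ← Complex.ofReal_pow, Real.sq_sqrt (Nat.cast_nonneg p)]
      simp
    have h3 : (starRingEnd ℂ) (piFrob p) ^ 2 = -p := by
      rw [← map_pow, h2]
      simp
    rw [← two_mul, pow_mul, pow_mul, h2, h3]
    ring
  rw [hpi]
  have hJm : (J - (-p : ℂ) ^ m) * (J + (-p : ℂ) ^ m) = 0 := by
    have : ((-p : ℂ) ^ m) ^ 2 = (p : ℂ) ^ (m + m) := by
      rw [← pow_mul, mul_comm, pow_mul, neg_sq, ← pow_mul, two_mul]
    push_cast at hnorm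
    linear_combination hnorm - this
  rcases mul_eq_zero.1 hJm with h | h
  · exfalso
    have hJe : J = (-p : ℂ) ^ m := sub_eq_zero.1 h
    rw [hJe] at hcount
    have hint : (9 : ℤ) * cubePairCount F s = (p : ℤ) ^ (m + m) - 8 + ((-p : ℤ) ^ m + (-p : ℤ) ^ m) := by
      exact_mod_cast hcount
    have h3 := congrArg (Int.cast : ℤ → ZMod 3) hint
    push_cast at h3
    rw [hp3, neg_neg, one_pow, Even.neg_one_pow ⟨m, rfl⟩, show (9 : ZMod 3) = 0 by decide,
      zero_mul] at h3
    exact absurd h3 (by decide)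
  · linear_combination 2 * h

/-- For a cube root of unity `c`, the sum `c + c ^ 2` is 2 if `c = 1` and `-1` otherwise. -/
theorem epsOne_eq {q s n : ℕ} (hq : q = 3 * s + 1) {ω : ℂ} (hω : IsPrimitiveRoot ω 3) :
    (epsOne q n : ℂ) = -(ω ^ (n + 2 * s) + (ω ^ (n + 2 * s)) ^ 2) := by
  have hiff : (q : ℤ) - 3 * (n : ℤ) ≡ 1 [ZMOD 9] ↔ 3 ∣ n + 2 * s := by
    rw [Int.modEq_iff_dvd, hq]
    push_cast
    omega
  rw [epsOne]
  simp only [hiff, ← hω.pow_eq_one_iff_dvd]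
  split_ifs with h
  · rw [h]
    norm_num
  · have h3 : (ω ^ (n + 2 * s)) ^ 3 = 1 := by
      rw [← pow_mul, mul_comm, pow_mul, hω.pow_eq_one, one_pow]
    have : (ω ^ (n + 2 * s)) ^ 2 + ω ^ (n + 2 * s) + 1 = 0 := by
      refine (mul_eq_zero.1 ?_).resolve_left (sub_ne_zero.2 h)
      linear_combination h3
    push_cast
    linear_combination this

end Count

/-! ### Assembly of the count. -/

theorem theorem4p5 {F : Type*} [Field F] [Fintype F] (p k q n : ℕ)
    (hp : p.Prime) (hq : q = p ^ k) (hF : Fintype.card F = q)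
    (hq3 : q ≡ 1 [MOD 3]) (hn : 0 < n) (hgcd : Nat.gcd n ((q - 1) / 3) = 1) :
    (∃! κ : ℤ, IsKappa p κ) ∧
    (Set.ncard {a : F | IsPermutationPolynomial
        ((Polynomial.X : Polynomial F) ^ n *
          (Polynomial.X ^ ((q - 1) / 3) + Polynomial.C a))} : ℂ) =
      (2 * (q : ℂ) - 3 * ((epsOne q n : ℂ) + (epsTwo n : ℂ)) - 10
        - 2 * (piFrob p ^ k + (starRingEnd ℂ) (piFrob p) ^ k)) / 9 := by
  have : Fact p.Prime := ⟨hp⟩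
  have hq1 : 1 < q := hF ▸ Fintype.one_lt_card
  have hp3 : p ≠ 3 := by
    rintro rfl
    have hk : k ≠ 0 := by
      rintro rfl
      simp [hq] at hq1
    have h3 : 3 ∣ q := hq ▸ dvd_pow_self 3 hk
    have := Nat.ModEq.symm hq3
    rw [Nat.ModEq, Nat.eq_zero_of_dvd_of_lt ((Nat.dvd_mod_iff dvd_rfl).2 h3)
      (Nat.mod_lt _ (by norm_num))] at this
    omega
  refine ⟨existsUnique_isKappa hp hp3, ?_⟩
  obtain ⟨s, hs⟩ : ∃ s, q = 3 * s + 1 := ⟨(q - 1) / 3, by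
    have : q % 3 = 1 := hq3
    omega⟩
  have hs' : (q - 1) / 3 = s := by omega
  rw [hs'] at hgcd ⊢
  have hFs : Fintype.card F = 3 * s + 1 := hF.trans hs
  obtain ⟨χ, hχ, hJ⟩ : ∃ χ : MulChar F ℂ, orderOf χ = 3 ∧
      jacobiSum χ χ + jacobiSum χ⁻¹ χ⁻¹ = -(piFrob p ^ k + (starRingEnd ℂ) (piFrob p) ^ k) := by
    have hmod : p % 3 = 1 ∨ p % 3 = 2 := by
      have : ¬ 3 ∣ p := fun h => hp3 ((Nat.prime_dvd_prime_iff_eq Nat.prime_three hp).1 h).symm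
      omega
    rcases hmod with h | h
    · exact exists_jacobiSum_eq_of_one_mod_three (hF.trans hq) h
    · exact exists_jacobiSum_eq_of_two_mod_three (hF.trans hq) h hFs
  obtain ⟨ω, hω, hcard⟩ := ncard_isPermutationPolynomial_binomial hFs hn hgcd hχ
  have hc : (ω ^ (n + 2 * s)) ^ 3 = 1 := by
    rw [← pow_mul, mul_comm, pow_mul, hω.pow_eq_one, one_pow]
  have hT := nine_mul_card_distinct hχ hc
  -- The correction for the discarded point `t = -ζ`, expressed through `ε₂`.
  have heps : (if 3 ∣ n then (0 : ℂ) else 1) = (epsTwo n + 2) / 3 := by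
    rw [epsTwo]
    simp only [Nat.modEq_zero_iff_dvd]
    split_ifs <;> norm_num
  rw [hJ, hF] at hT
  rw [hcard, heps, epsOne_eq hs hω, eq_div_iff (by norm_num)]
  linear_combination hT
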